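/- Let $K$ be a field, $S=K[x_1,\ldots,x_4]$, and let $I\subseteq J$ be ideals of $S$, each generated by squarefree monomials, with $I\neq 0$ and $I\neq J$. Then $$\operatorname{sdepth}_S J/I\;\geq\;\operatorname{depth}_S J/I .$$ Here $\operatorname{depth}_S M$ is the maximal length of an $M$-regular sequence contained in $(x_1,\ldots,x_4)$. For a finitely generated multigraded $S$-module $M$, a Stanley decomposition of $M$ is a presentation of the $K$-vector space $M$ as a finite direct sum $M=\bigoplus_{i=1}^r m_iK[Z_i]$, where each $m_i\in M$ is a nonzero multihomogeneous element, $Z_i\subseteq\{x_1,\ldots,x_4\}$, and $m_iK[Z_i]=\{m_if : f\in K[Z_i]\}$ is a free $K[Z_i]$-module; and $\operatorname{sdepth}_S M$ is the maximum, over all Stanley decompositions of $M$, of $\min_i |Z_i|$. -/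

import Mathlib

open MvPolynomial

/-- A squarefree monomial ideal of `K[x_i : i ∈ σ]`: an ideal generated by squarefree monomials
(monomials all of whose exponents are at most `1`). The zero ideal and the unit ideal are
included. -/
def IsSquarefreeMonomialIdeal {K σ : Type*} [Field K] (I : Ideal (MvPolynomial σ K)) : Prop :=
  ∃ s : Set (σ →₀ ℕ), (∀ a ∈ s, ∀ i, a i ≤ 1) ∧
    I = Ideal.span ((fun a : σ →₀ ℕ => (monomial a (1 : K) : MvPolynomial σ K)) '' s)

/-- The factor module `J / I` of two ideals of `K[x_i : i ∈ σ]`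
(literally `J / (I ∩ J)`, which is `J / I` when `I ⊆ J`). -/
abbrev FactorModule {K σ : Type*} [Field K] (I J : Ideal (MvPolynomial σ K)) : Type _ :=
  (↥J) ⧸ Submodule.submoduleOf I J

/-- The multigraded component of `J / I` in degree `a`: the classes of the elements of `J` that are
scalar multiples of the monomial `x^a`. -/
noncomputable def FactorModule.component {K σ : Type*} [Field K] (I J : Ideal (MvPolynomial σ K))
    (a : σ →₀ ℕ) : Submodule K (FactorModule I J) :=
  ((Submodule.span K {(monomial a (1 : K) : MvPolynomial σ K)}).comap
    ((Submodule.subtype J).restrictScalars K)).map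
      ((Submodule.mkQ (Submodule.submoduleOf I J)).restrictScalars K)

section StanleyDepth

variable {K σ M ι : Type*} [Field K] [AddCommGroup M] [Module K M]
  [Module (MvPolynomial σ K) M] [IsScalarTower K (MvPolynomial σ K) M]

/-- The subspace `m K[Z] = {m f : f ∈ K[Z]}` of `M`, as a module over the polynomial subring
`K[Z]`, for `Z` a finite set of variables. -/
noncomputable def stanleySpace (K : Type*) {σ M : Type*} [Field K] [AddCommGroup M]
    [Module (MvPolynomial σ K) M] (m : M) (Z : Finset σ) :
    Submodule (supported K (Z : Set σ)) M :=
  Submodule.span (supported K (Z : Set σ)) {m}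

/-- A Stanley decomposition of a multigraded module `M` with homogeneous components `𝓜`:
finitely many Stanley spaces `m_i K[Z_i]`, with `m_i` a nonzero homogeneous element and
`m_i K[Z_i]` a free `K[Z_i]`-module, whose internal direct sum, as a `K`-vector space, is `M`. -/
structure StanleyDecomposition (𝓜 : ι → Submodule K M) where
  /-- number of Stanley spaces -/
  r : ℕ
  /-- generators of the Stanley spaces -/
  m : Fin r → M
  /-- variable sets of the Stanley spaces -/
  Z : Fin r → Finset σ
  homogeneous : ∀ i, SetLike.IsHomogeneousElem 𝓜 (m i)
  ne_zero : ∀ i, m i ≠ 0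
  free : ∀ i, Module.Free (supported K (Z i : Set σ)) (stanleySpace K (m i) (Z i))
  isInternal : DirectSum.IsInternal
    fun i => (stanleySpace K (m i) (Z i)).restrictScalars K

/-- The Stanley depth of a decomposition: the least dimension `|Z_i|` of its Stanley spaces
(`⊤` for the empty decomposition of the zero module). -/
noncomputable def StanleyDecomposition.sdepth {𝓜 : ι → Submodule K M}
    (D : StanleyDecomposition (σ := σ) 𝓜) : ℕ∞ :=
  ⨅ i, ((D.Z i).card : ℕ∞)

/-- The Stanley depth of a multigraded module: the maximum of the Stanley depths of its Stanley
decompositions. -/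
noncomputable def stanleyDepth (σ : Type*) {K M ι : Type*} [Field K] [AddCommGroup M] [Module K M]
    [Module (MvPolynomial σ K) M] [IsScalarTower K (MvPolynomial σ K) M]
    (𝓜 : ι → Submodule K M) : ℕ∞ :=
  ⨆ D : StanleyDecomposition (σ := σ) 𝓜, D.sdepth

end StanleyDepth

/-- The depth of a module `M` over `K[x_i : i ∈ σ]`: the supremum of the lengths of the
`M`-regular sequences contained in the ideal `(x_i : i ∈ σ)`. -/
noncomputable def polyDepth (K σ M : Type*) [Field K] [AddCommGroup M]
    [Module (MvPolynomial σ K) M] : ℕ∞ :=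
  ⨆ rs : {rs : List (MvPolynomial σ K) //
      (∀ f ∈ rs, f ∈ Ideal.span (Set.range (X : σ → MvPolynomial σ K))) ∧
        RingTheory.Sequence.IsRegular M rs},
    (rs.1.length : ℕ∞)

/-! Whether a monomial lies in a squarefree monomial ideal depends only on its support, so `J / I`
is governed by the family Q (`sqfreeFamily`) of sets A of variables with x_A in J and not in I. Q is
convex for inclusion, and it omits the full set because I is nonzero. A partition of Q into
intervals [A, B] gives a decomposition of `J / I` into the Stanley spaces x_A K[B]
(`IsIntervalPartition.le_stanleyDepth`). So, given a regular sequence of length t in the variable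
ideal, it suffices to partition Q into intervals whose tops have at least t elements. Here t < 4,
because a nonzero element of I kills the module (`length_lt_of_isRegular`), and t = 0 is trivial.

For t = 1, 2, 3 the regular sequence forces the Koszul cohomology of `J / I` with respect to the
variables to vanish below degree t (`koszul_exact_zero`, `koszul_exact_one`, `koszul_exact_two`).
Applied to explicit cocycles with squarefree monomial entries, this yields purely combinatorial
conditions on Q, which no longer mention K: `HasVertices`, `IsConnectedLink` for the links of the
empty set and of single vertices, and `PairsLeTriples`.

What remains is a finite statement: every convex family of proper subsets of a 4-set that meets
these conditions for t has the desired partition. Families are coded as numbers below 2^15 and all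
of them are checked by evaluation (`partitionTest_eq_true`). -/

/-! ### Vanishing of Koszul cohomology in degrees 0, 1, 2. -/

section Koszul

open RingTheory.Sequence

variable {R M ι : Type*} [CommRing R] [AddCommGroup M] [Module R M] [Fintype ι] {x : ι → R}

/-- A module on which some element of `(x_i)` is regular has no nonzero element killed by all
the `x_i`. -/
theorem koszul_exact_zero {f : R} {rs : List R} (hx : f ∈ Ideal.span (Set.range x))
    (h : IsWeaklyRegular M (f :: rs)) {u : M} (hu : ∀ i, x i • u = 0) : u = 0 := by
  obtain ⟨c, rfl⟩ := Ideal.mem_span_range_iff_exists_fun.1 hx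
  rw [isWeaklyRegular_cons_iff] at h
  apply h.1
  simp [Finset.sum_smul, mul_smul, hu]

theorem mk_quotSMulTop_eq_zero_iff {f : R} {u : M} :
    (Submodule.Quotient.mk u : QuotSMulTop f M) = 0 ↔ ∃ v : M, f • v = u := by
  rw [Submodule.Quotient.mk_eq_zero, Submodule.mem_smul_pointwise_iff_exists]
  simp

/-- The first Koszul cohomology of a module vanishes in the presence of a regular sequence of
length two. -/
theorem koszul_exact_one {f g : R} {rs : List R} (hf : f ∈ Ideal.span (Set.range x))
    (hg : g ∈ Ideal.span (Set.range x)) (h : IsWeaklyRegular M (f :: g :: rs)) {u : ι → M}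
    (hu : ∀ i j, x i • u j = x j • u i) : ∃ v, ∀ i, u i = x i • v := by
  obtain ⟨c, hc⟩ := Ideal.mem_span_range_iff_exists_fun.1 hf
  rw [isWeaklyRegular_cons_iff] at h
  -- Contraction with `c` is a homotopy between multiplication by f = Σ c_i x_i and zero. Hence the
  -- contracted cocycle is again a cocycle modulo f, one degree lower, where the previous case
  -- applies over M/fM with the rest of the sequence.
  have key : ∀ j, x j • ∑ i, c i • u i = f • u j := fun j => by
    rw [← hc, Finset.sum_smul, Finset.smul_sum]
    exact Finset.sum_congr rfl fun i _ => by rw [smul_comm, hu j i, mul_smul]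
  obtain ⟨v, hv⟩ := mk_quotSMulTop_eq_zero_iff.1 <| koszul_exact_zero hg h.2
    (u := Submodule.Quotient.mk (∑ i, c i • u i)) fun j =>
      mk_quotSMulTop_eq_zero_iff.2 ⟨u j, (key j).symm⟩
  refine ⟨v, fun j => h.1 ?_⟩
  simp only
  rw [← key, ← hv, smul_comm]

/-- The second Koszul cohomology of a module vanishes in the presence of a regular sequence of
length three. -/
theorem koszul_exact_two {f g k : R} {rs : List R} (hf : f ∈ Ideal.span (Set.range x))
    (hg : g ∈ Ideal.span (Set.range x)) (hk : k ∈ Ideal.span (Set.range x))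
    (h : IsWeaklyRegular M (f :: g :: k :: rs)) {u : ι → ι → M}
    (hu : ∀ i j l, x i • u j l - x j • u i l + x l • u i j = 0) :
    ∃ v : ι → M, ∀ i j, u i j = x i • v j - x j • v i := by
  obtain ⟨c, hc⟩ := Ideal.mem_span_range_iff_exists_fun.1 hf
  rw [isWeaklyRegular_cons_iff] at h
  -- The same homotopy, one degree higher: the contraction of `u` becomes a 1-cocycle modulo f.
  have key : ∀ j l, x j • ∑ i, c i • u i l - x l • ∑ i, c i • u i j = f • u j l := fun j l => by
    rw [← hc, Finset.sum_smul, Finset.smul_sum, Finset.smul_sum, ← Finset.sum_sub_distrib]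
    refine Finset.sum_congr rfl fun i _ => ?_
    have := congrArg (c i • ·) (hu i j l)
    simp only [smul_add, smul_sub, smul_zero, ← mul_smul] at this ⊢
    rw [mul_comm (x j), mul_comm (x l), ← sub_eq_zero, ← neg_eq_zero, ← this]
    abel
  obtain ⟨z, hz⟩ := koszul_exact_one hg hk h.2
    (u := fun j => Submodule.Quotient.mk (∑ i, c i • u i j)) fun j l => by
      rw [← sub_eq_zero]
      exact mk_quotSMulTop_eq_zero_iff.2 ⟨u j l, (key j l).symm⟩
  obtain ⟨z, rfl⟩ := Submodule.Quotient.mk_surjective _ z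
  -- The contraction equals x_j z up to a multiple f v_j. This correction term bounds `u` after
  -- cancelling f.
  choose v hv using fun j => mk_quotSMulTop_eq_zero_iff.1 (sub_eq_zero.2 (hz j))
  refine ⟨v, fun i j => h.1 ?_⟩
  simp only
  rw [← key, smul_sub, smul_comm f, smul_comm f, hv, hv, smul_sub, smul_sub, smul_comm (x i) (x j)]
  abel

end Koszul

/-! ### Bounding the length of a regular sequence by dimension. -/

/-- A regular element avoids the minimal primes of the support, so each quotient step lowers the
dimension by at least one. -/
theorem RingTheory.Sequence.IsRegular.length_le_supportDim {R : Type*} [CommRing R]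
    [IsNoetherianRing R] {M : Type*} [AddCommGroup M] [Module R M] [Module.Finite R M]
    {rs : List R} (h : RingTheory.Sequence.IsRegular M rs) :
    (rs.length : WithBot ℕ∞) ≤ Module.supportDim R M := by
  induction rs generalizing M with
  | nil =>
    have := h.nontrivial
    obtain ⟨d, hd⟩ := WithBot.ne_bot_iff_exists.1 (Module.supportDim_ne_bot_of_nontrivial R M)
    rw [← hd]
    simp
  | cons f rs ih =>
    rw [RingTheory.Sequence.isRegular_cons_iff] at h
    refine le_trans ?_ (Module.supportDim_quotSMulTop_succ_le_of_notMem_minimalPrimes (x := f)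
      fun p hp => h.1.notMem_of_mem_minimalPrimes hp)
    push_cast [List.length_cons]
    gcongr
    exact ih h.2

/-- The support lies in the hypersurface g = 0, whose dimension is at most n - 1. -/
theorem MvPolynomial.length_lt_of_isRegular {K : Type*} [Field K] {n : ℕ} {M : Type*}
    [AddCommGroup M] [Module (MvPolynomial (Fin n) K) M] [Module.Finite (MvPolynomial (Fin n) K) M]
    {g : MvPolynomial (Fin n) K} (hg : g ≠ 0) (hM : ∀ u : M, g • u = 0)
    {rs : List (MvPolynomial (Fin n) K)} (h : RingTheory.Sequence.IsRegular M rs) :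
    rs.length < n := by
  have h1 := h.length_le_supportDim
  rw [Module.supportDim_eq_ringKrullDim_quotient_annihilator] at h1
  have h2 : ringKrullDim (MvPolynomial (Fin n) K ⧸ Module.annihilator (MvPolynomial (Fin n) K) M)
      ≤ ringKrullDim (MvPolynomial (Fin n) K ⧸ Ideal.span {g}) :=
    ringKrullDim_le_of_surjective (Ideal.Quotient.factor (by
      rw [Ideal.span_singleton_le_iff_mem, Module.mem_annihilator]
      exact hM)) (Ideal.Quotient.factor_surjective _)
  have h3 := ringKrullDim_quotient_succ_le_of_nonZeroDivisor (mem_nonZeroDivisors_of_ne_zero hg)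
  rw [MvPolynomial.ringKrullDim_of_isNoetherianRing, ringKrullDim_eq_zero_of_field] at h3
  have h4 : ((rs.length : WithBot ℕ∞) + 1) ≤ n := by
    refine le_trans (by gcongr; exact h1.trans h2) (h3.trans ?_)
    simp
  exact_mod_cast h4

/-! ### Families of subsets of a 4-set: the coded search and tests. -/

section IntervalPartition

/-- Bounded universal quantifier with values in `Bool`. -/
def allBelow (f : ℕ → Bool) : ℕ → Bool
  | 0 => true
  | n + 1 => f n && allBelow f n

theorem allBelow_eq_true {f : ℕ → Bool} {n : ℕ} : allBelow f n = true ↔ ∀ k < n, f k = true := by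
  induction n with
  | zero => simp [allBelow]
  | succ n ih => rw [allBelow, Bool.and_eq_true, ih, Nat.forall_lt_succ_right, and_comm]

/-- The binary digits of a number, in a form which the kernel evaluates quickly. -/
def bit (p A : ℕ) : Bool := Nat.beq (Nat.land (Nat.shiftRight p A) 1) 1

/-- The inclusion of finite sets coded by binary digits. -/
def sub (A B : ℕ) : Bool := Nat.beq (Nat.land A B) A

/-- Evaluation of a function, after its argument has been reduced to a numeral. -/
def force (f : ℕ → Bool) : ℕ → Bool
  | 0 => f 0
  | n + 1 => f (n + 1)

/-- One binary digit of the enumeration of an interval of the Boolean lattice: adjoin the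
translates by `i` if `i` belongs to the set `D`. -/
def intervalStep (D i m : ℕ) : ℕ :=
  bif bit D i then Nat.lor m (Nat.shiftLeft m (Nat.shiftLeft 1 i)) else m

/-- The set of all `C` with `A ⊆ C ⊆ B`, for `A ⊆ B ⊆ {0, 1, 2, 3}`. Subsets of `{0, 1, 2, 3}` are
coded by the numbers below `16`, and sets of such subsets by the numbers below `2 ^ 16`. -/
def intervalCode (A B : ℕ) : ℕ :=
  intervalStep (Nat.xor A B) 3 <| intervalStep (Nat.xor A B) 2 <|
    intervalStep (Nat.xor A B) 1 <| intervalStep (Nat.xor A B) 0 (Nat.shiftLeft 1 A)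

/-- The codes of the sets with `t` elements. -/
def layer : ℕ → List ℕ
  | 0 => [0]
  | 1 => [1, 2, 4, 8]
  | 2 => [3, 5, 6, 9, 10, 12]
  | 3 => [7, 11, 13, 14]
  | _ => [15]

/-- The codes of the sets with fewer than `t` elements. -/
def lower : ℕ → List ℕ
  | 0 => []
  | 1 => [0]
  | 2 => [0, 1, 2, 4, 8]
  | _ => [0, 1, 2, 4, 8, 3, 5, 6, 9, 10, 12]

/-- The test whether the members with fewer than `t` elements of the family `p` can be covered by
at most `n` disjoint intervals in `p` whose tops have `t` elements. -/
def hasPartition (t : ℕ) : ℕ → ℕ → Bool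
  | 0, _ => false
  | n + 1, p =>
      match (lower t).find? (bit p) with
      | none => true
      | some A => (layer t).any fun B => sub A B &&
          (sub (intervalCode A B) p && force (hasPartition t n) (Nat.xor p (intervalCode A B)))

/-- The pairs `(c, m)` with `c` the code of a pair `A ⊆ B` with at least two elements of difference
and `m` the code of the interval between them. -/
def convexPairs : List (ℕ × ℕ) :=
  [(9, 15), (33, 51), (65, 85), (129, 255), (513, 771), (1025, 1285), (2049, 3855), (4097, 4369),
    (8193, 13107), (16385, 21845), (32769, 65535), (130, 170), (2050, 2570), (8194, 8738),
    (32770, 43690), (132, 204), (2052, 3084), (16388, 17476), (32772, 52428), (32776, 34952),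
    (144, 240), (8208, 12336), (16400, 20560), (32784, 61680), (32800, 41120), (32832, 49344),
    (2304, 3840), (8448, 13056), (16640, 21760), (33024, 65280), (33280, 43520), (33792, 52224),
    (36864, 61440)]

/-- The test whether the family `p` is convex. -/
def isConvexCode (p : ℕ) : Bool :=
  convexPairs.all fun x => !sub x.1 p || sub x.2 p

/-- The code of the set of all `i < 4` with `f i = true`. -/
def encode (f : ℕ → Bool) : ℕ :=
  Nat.lor (bif f 0 then 1 else 0) <| Nat.lor (bif f 1 then 2 else 0) <|
    Nat.lor (bif f 2 then 4 else 0) (bif f 3 then 8 else 0)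

/-- The test whether all subsets `S` of the set `V` of vertices of the link of `L` in the family `p`
which are closed under adjacency are trivial: empty, or everything provided that `L` itself belongs
to `p`. -/
def isConnectedLinkAux (p L V : ℕ) : Bool :=
  allBelow (fun S => !sub S V || (Nat.beq S 0 || ((bit p L && sub V S) ||
    !allBelow (fun i => bit L i || allBelow (fun j => bit L j || (bit S i == bit S j ||
      !bit p (Nat.lor (Nat.lor L (Nat.shiftLeft 1 i)) (Nat.shiftLeft 1 j)))) i) 4))) 16

/-- The test whether all sets of vertices of the link of `L` in the family `p` which are closed
under adjacency are trivial. -/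
def isConnectedLink (p L : ℕ) : Bool :=
  force (isConnectedLinkAux p L)
    (encode fun i => !bit L i && bit p (Nat.lor L (Nat.shiftLeft 1 i)))

/-- The test whether `p` has at least `t` vertices, if it contains the empty set. -/
def hasVertices (t p : ℕ) : Bool :=
  !bit p 0 || (layer (t - 1)).all fun E =>
    !allBelow (fun j => bit E j || !bit p (Nat.shiftLeft 1 j)) 4

/-- The test whether `p` has at most as many pairs as triples, if it has no smaller sets. -/
def pairsLeTriples (p : ℕ) : Bool :=
  bit p 0 || (!(layer 1).all (fun i => !bit p i) ||
    Nat.ble ((layer 2).countP (bit p)) ((layer 3).countP (bit p)))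

/-- The combinatorial consequences of depth at least `t`. -/
def depthTest : ℕ → ℕ → Bool
  | 1, p => hasVertices 1 p
  | 2, p => hasVertices 2 p && isConnectedLink p 0
  | 3, p => hasVertices 3 p && (pairsLeTriples p && (isConnectedLink p 0 &&
      allBelow (fun l => isConnectedLink p (Nat.shiftLeft 1 l)) 4))
  | _, _ => false

/-- The test whether the combinatorial consequences of depth imply the existence of a partition. -/
def partitionTest (p : ℕ) : Bool :=
  allBelow (fun t => hasPartition (t + 1) 12 p || !depthTest (t + 1) p) 3

-- The whole combinatorial content, by evaluation. In p = 256 a + b, the bits of b stand for the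
-- sets without the element 3 and those of a for the sets containing it; a < 128 leaves out the full
-- set. Both halves of a convex family are convex, so testing them first prunes the enumeration. The
-- fuel 12 in `partitionTest` is enough: each round of `hasPartition` removes at least one of the at
-- most 11 small sets, and one more round detects the end.
set_option maxRecDepth 100000 in
theorem partitionTest_eq_true :
    allBelow (fun a => !isConvexCode a || allBelow (fun b => !isConvexCode b ||
      force (fun p => !isConvexCode p || partitionTest p) (a <<< 8 ||| b)) 256) 128 = true := by
  decide +kernel

/-! ### Soundness of the search and the tests. -/

theorem bit_eq_testBit (p A : ℕ) : bit p A = p.testBit A := by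
  rw [Bool.eq_iff_iff, Nat.testBit_eq_decide_div_mod_eq]
  change Nat.beq (p >>> A &&& 1) 1 = true ↔ _
  simp [Nat.beq_eq, Nat.and_one_is_mod, Nat.shiftRight_eq_div_pow]

theorem sub_iff {A B : ℕ} : sub A B = true ↔ ∀ i, bit A i = true → bit B i = true := by
  change Nat.beq (A &&& B) A = true ↔ _
  simp only [bit_eq_testBit, Nat.beq_eq]
  constructor
  · intro h i hi
    rw [← h] at hi
    simp at hi
    exact hi.2
  · intro h
    refine Nat.eq_of_testBit_eq fun i => ?_
    have := h i
    rw [Nat.testBit_and]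
    cases hA : A.testBit i <;> simp_all

theorem force_eq (f : ℕ → Bool) (n : ℕ) : force f n = f n := by
  cases n <;> rfl

/-- The subset of `{0, 1, 2, 3}` with a given code. -/
def decode (A : ℕ) : Finset (Fin 4) := Finset.univ.filter fun i => bit A i

theorem mem_decode {A : ℕ} {i : Fin 4} : i ∈ decode A ↔ bit A i = true := by
  simp [decode]

theorem exists_decode (s : Finset (Fin 4)) : ∃ A < 16, decode A = s := by
  revert s; decide

theorem bit_eq_false_of_lt {A i : ℕ} (hA : A < 16) (hi : 4 ≤ i) : bit A i = false := by
  rw [bit_eq_testBit]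
  exact Nat.testBit_eq_false_of_lt (hA.trans_le (Nat.pow_le_pow_right (n := 2) (by norm_num) hi))

theorem sub_iff_decode {A B : ℕ} (hA : A < 16) : sub A B = true ↔ decode A ⊆ decode B := by
  rw [sub_iff]
  constructor
  · intro h i
    simpa only [mem_decode] using h i
  · intro h i hi
    by_cases h4 : i < 4
    · exact mem_decode.1 (h (mem_decode.2 hi : (⟨i, h4⟩ : Fin 4) ∈ decode A))
    · rw [bit_eq_false_of_lt hA (not_lt.1 h4)] at hi
      simp at hi

theorem decode_injOn {A B : ℕ} (hA : A < 16) (hB : B < 16) (h : decode A = decode B) : A = B := by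
  have h1 := sub_iff.1 ((sub_iff_decode hA).2 h.subset)
  have h2 := sub_iff.1 ((sub_iff_decode hB).2 h.symm.subset)
  refine Nat.eq_of_testBit_eq fun i => ?_
  rw [← bit_eq_testBit, ← bit_eq_testBit, Bool.eq_iff_iff]
  exact ⟨h1 i, h2 i⟩

theorem bit_intervalCode {A B C : ℕ} (hA : A < 16) (hB : B < 16) (hC : C < 16)
    (hAB : sub A B = true) : bit (intervalCode A B) C = (sub A C && sub C B) := by
  have h : allBelow (fun A => allBelow (fun B => !sub A B || allBelow (fun C =>
      bit (intervalCode A B) C == (sub A C && sub C B)) 16) 16) 16 = true := by decide +kernel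
  have := allBelow_eq_true.1 (allBelow_eq_true.1 h A hA) B hB
  rw [hAB, Bool.not_true, Bool.false_or] at this
  simpa using allBelow_eq_true.1 this C hC

theorem bit_xor (p q A : ℕ) : bit (Nat.xor p q) A = (bit p A ^^ bit q A) := by
  simp only [bit_eq_testBit]
  exact Nat.testBit_xor p q A

theorem layer_spec {t B : ℕ} (ht : t < 4) (hB : B ∈ layer t) : B < 16 ∧ (decode B).card = t := by
  have : ∀ t < 4, ∀ B ∈ layer t, B < 16 ∧ (decode B).card = t := by decide
  exact this t ht B hB

theorem le_card_of_notMem_lower {t A : ℕ} (ht : t < 4) (hA : A < 16) (h : A ∉ lower t) :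
    t ≤ (decode A).card := by
  have : ∀ t < 4, ∀ A < 16, A ∉ lower t → t ≤ (decode A).card := by decide
  exact this t ht A hA h

theorem lt_of_mem_lower {t A : ℕ} (h : A ∈ lower t) : A < 16 := by
  have h3 : ∀ A ∈ lower 3, A < 16 := by decide
  match t with
  | 0 => simp [lower] at h
  | 1 => revert A; decide
  | 2 => revert A; decide
  | _ + 3 => exact h3 A h

/-- A family of subsets of `{0, 1, 2, 3}` is partitioned by the intervals in `F`, all of whose tops
have at least `t` elements. -/
structure IsIntervalPartition (Q : Finset (Fin 4) → Prop) (t : ℕ)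
    (F : Finset (Finset (Fin 4) × Finset (Fin 4))) : Prop where
  subset : ∀ x ∈ F, x.1 ⊆ x.2
  le_card : ∀ x ∈ F, t ≤ x.2.card
  mem : ∀ x ∈ F, ∀ C, x.1 ⊆ C → C ⊆ x.2 → Q C
  exists_mem : ∀ C, Q C → ∃ x ∈ F, x.1 ⊆ C ∧ C ⊆ x.2
  eq_of_mem : ∀ x ∈ F, ∀ y ∈ F, ∀ C, x.1 ⊆ C → C ⊆ x.2 → y.1 ⊆ C → C ⊆ y.2 → x = y

/-- The family of sets coded by `p`. -/
def decodeFamily (p : ℕ) (s : Finset (Fin 4)) : Prop := ∃ A < 16, decode A = s ∧ bit p A = true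

theorem decodeFamily_decode {p A : ℕ} (hA : A < 16) :
    decodeFamily p (decode A) ↔ bit p A = true :=
  ⟨fun ⟨_, hB, h, hb⟩ => decode_injOn hB hA h ▸ hb, fun h => ⟨A, hA, rfl, h⟩⟩

theorem exists_isIntervalPartition_of_hasPartition {t n p : ℕ} (ht : t < 4)
    (h : hasPartition t n p = true) :
    ∃ F, IsIntervalPartition (decodeFamily p) t F := by
  induction n generalizing p with
  | zero => simp [hasPartition] at h
  | succ n ih =>
    rw [hasPartition] at h
    split at h
    next h0 =>
      rw [List.find?_eq_none] at h0
      -- No small set is left, so the remaining members can stand as one-point intervals.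
      refine ⟨((Finset.range 16).filter fun A => bit p A).image fun A => (decode A, decode A),
        ?_, ?_, ?_, ?_, ?_⟩
      · simp only [Finset.mem_image]
        rintro _ ⟨A, -, rfl⟩
        exact subset_rfl
      · simp only [Finset.mem_image, Finset.mem_filter, Finset.mem_range]
        rintro _ ⟨A, ⟨hA, hb⟩, rfl⟩
        exact le_card_of_notMem_lower ht hA fun h => h0 A h hb
      · simp only [Finset.mem_image, Finset.mem_filter, Finset.mem_range]
        rintro _ ⟨A, ⟨hA, hb⟩, rfl⟩ C h1 h2
        exact ⟨A, hA, subset_antisymm h1 h2, hb⟩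
      · rintro _ ⟨A, hA, rfl, hb⟩
        exact ⟨(decode A, decode A), Finset.mem_image.2 ⟨A, by simp [hA, hb], rfl⟩,
          subset_rfl, subset_rfl⟩
      · simp only [Finset.mem_image]
        rintro _ ⟨A, -, rfl⟩ _ ⟨B, -, rfl⟩ C h1 h2 h3 h4
        have : decode A = decode B := (subset_antisymm h1 h2).trans (subset_antisymm h3 h4).symm
        rw [this]
    next A h0 =>
      have hA := lt_of_mem_lower (List.mem_of_find?_eq_some h0)
      simp only [List.any_eq_true, Bool.and_eq_true, force_eq] at h
      obtain ⟨B, hB, hAB, hp, h⟩ := h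
      obtain ⟨hB16, hBt⟩ := layer_spec ht hB
      obtain ⟨F, hF⟩ := ih h
      -- The interval is contained in `p`, so the exclusive or is the set difference.
      have hQ : ∀ C, decodeFamily (Nat.xor p (intervalCode A B)) C ↔
          decodeFamily p C ∧ ¬ (decode A ⊆ C ∧ C ⊆ decode B) := by
        intro C
        obtain ⟨C, hC, rfl⟩ := exists_decode C
        rw [decodeFamily_decode hC, decodeFamily_decode hC, ← sub_iff_decode hA,
          ← sub_iff_decode hC, bit_xor]
        have h1 := bit_intervalCode hA hB16 hC hAB
        have h2 := sub_iff.1 hp C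
        cases h3 : bit (intervalCode A B) C <;> rw [h3] at h1 <;> simp_all
      have hI : ∀ C, decode A ⊆ C → C ⊆ decode B → decodeFamily p C := by
        intro C
        obtain ⟨C, hC, rfl⟩ := exists_decode C
        rw [decodeFamily_decode hC, ← sub_iff_decode hA, ← sub_iff_decode hC]
        intro h1 h2
        exact sub_iff.1 hp C (by rw [bit_intervalCode hA hB16 hC hAB, h1, h2]; rfl)
      refine ⟨insert (decode A, decode B) F, ?_, ?_, ?_, ?_, ?_⟩
      · simp only [Finset.mem_insert]
        rintro x (rfl | hx)
        · exact (sub_iff_decode hA).1 hAB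
        · exact hF.subset x hx
      · simp only [Finset.mem_insert]
        rintro x (rfl | hx)
        · exact hBt.ge
        · exact hF.le_card x hx
      · simp only [Finset.mem_insert]
        rintro x (rfl | hx) C h1 h2
        · exact hI C h1 h2
        · exact ((hQ C).1 (hF.mem x hx C h1 h2)).1
      · intro C hC
        by_cases h1 : decode A ⊆ C ∧ C ⊆ decode B
        · exact ⟨_, Finset.mem_insert_self _ _, h1⟩
        · obtain ⟨x, hx, h⟩ := hF.exists_mem C ((hQ C).2 ⟨hC, h1⟩)
          exact ⟨x, Finset.mem_insert_of_mem hx, h⟩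
      · simp only [Finset.mem_insert]
        rintro x (rfl | hx) y (rfl | hy) C h1 h2 h3 h4
        · rfl
        · exact absurd ⟨h1, h2⟩ ((hQ C).1 (hF.mem y hy C h3 h4)).2
        · exact absurd ⟨h3, h4⟩ ((hQ C).1 (hF.mem x hx C h1 h2)).2
        · exact hF.eq_of_mem x hx y hy C h1 h2 h3 h4

theorem decode_insert {A : ℕ} (i : Fin 4) :
    decode (Nat.lor A (Nat.shiftLeft 1 i)) = insert i (decode A) := by
  ext k
  rw [Finset.mem_insert, mem_decode, mem_decode, bit_eq_testBit, bit_eq_testBit]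
  change (A ||| 1 <<< (i : ℕ)).testBit k = true ↔ _
  rw [Nat.testBit_or, Nat.one_shiftLeft, Nat.testBit_two_pow, Bool.or_eq_true, or_comm, Fin.ext_iff,
    decide_eq_true_iff, eq_comm]

theorem insert_code_lt {A : ℕ} (hA : A < 16) (i : Fin 4) :
    Nat.lor A (Nat.shiftLeft 1 i) < 16 :=
  Nat.or_lt_two_pow (n := 4) hA (by revert i; decide)

theorem decode_zero : decode 0 = ∅ := by decide

/-- Sets of vertices in the link of `L` which are closed under adjacency are trivial: empty, or
everything provided that `L` belongs to the family. -/
def IsConnectedLink (Q : Finset (Fin 4) → Prop) (L : Finset (Fin 4)) : Prop :=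
  ∀ S : Finset (Fin 4), (∀ i ∈ S, i ∉ L ∧ Q (insert i L)) →
    (∀ i j, i ∉ L → j ∉ L → i ≠ j → Q (insert j (insert i L)) → (i ∈ S ↔ j ∈ S)) →
    S = ∅ ∨ (Q L ∧ ∀ j ∉ L, Q (insert j L) → j ∈ S)

/-- A family containing the empty set has a vertex outside of every set with fewer than `t`
elements. -/
def HasVertices (Q : Finset (Fin 4) → Prop) (t : ℕ) : Prop :=
  Q ∅ → ∀ E : Finset (Fin 4), E.card < t → ∃ j ∉ E, Q {j}

open Classical in
/-- A family without vertices has at most as many pairs as triples. -/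
def PairsLeTriples (Q : Finset (Fin 4) → Prop) : Prop :=
  ¬ Q ∅ → (∀ i, ¬ Q {i}) →
    (Finset.univ.filter fun x : Fin 4 × Fin 4 => x.1 < x.2 ∧ Q {x.1, x.2}).card ≤
      (Finset.univ.filter fun x : Fin 4 × Fin 4 × Fin 4 =>
        x.1 < x.2.1 ∧ x.2.1 < x.2.2 ∧ Q {x.1, x.2.1, x.2.2}).card

theorem encode_lt (f : ℕ → Bool) : encode f < 16 := by
  rw [encode]
  cases f 0 <;> cases f 1 <;> cases f 2 <;> cases f 3 <;> decide

theorem bit_encode (f : ℕ → Bool) (i : Fin 4) : bit (encode f) i = f i := by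
  rw [encode]
  fin_cases i <;> cases f 0 <;> cases f 1 <;> cases f 2 <;> cases f 3 <;> rfl

theorem isConnectedLink_eq_true {p L : ℕ} (hL : L < 16)
    (h : IsConnectedLink (decodeFamily p) (decode L)) : isConnectedLink p L = true := by
  rw [isConnectedLink, force_eq]
  set V := encode fun i => !bit L i && bit p (Nat.lor L (Nat.shiftLeft 1 i)) with hV
  have hV16 : V < 16 := encode_lt _
  have h1 (i : Fin 4) : i ∈ decode V ↔
      i ∉ decode L ∧ decodeFamily p (insert i (decode L)) := by
    rw [← decode_insert, decodeFamily_decode (insert_code_lt hL i), mem_decode, mem_decode, hV,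
      bit_encode, Bool.and_eq_true, Bool.not_eq_true', Bool.not_eq_true]
  have h2 (i j : Fin 4) : decodeFamily p (insert j (insert i (decode L))) ↔
      bit p (Nat.lor (Nat.lor L (Nat.shiftLeft 1 i)) (Nat.shiftLeft 1 j)) = true := by
    rw [← decode_insert, ← decode_insert,
      decodeFamily_decode (insert_code_lt (insert_code_lt hL i) j)]
  rw [isConnectedLinkAux, allBelow_eq_true]
  intro S hS
  by_contra hc
  simp only [Bool.or_eq_true, not_or, Bool.not_eq_true', Bool.not_eq_false, allBelow_eq_true,
    Bool.and_eq_true, not_and] at hc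
  obtain ⟨hSV, hS0, hVS, hcl⟩ := hc
  rw [sub_iff_decode hS] at hSV
  rw [sub_iff_decode hV16, ← decodeFamily_decode hL] at hVS
  have key : ∀ i j : Fin 4, i ∉ decode L → j ∉ decode L → j < i →
      decodeFamily p (insert j (insert i (decode L))) → (i ∈ decode S ↔ j ∈ decode S) := by
    intro i j hi hj hij hp
    rw [mem_decode] at hi hj
    rw [h2] at hp
    rcases ((hcl i i.2).resolve_left hi j hij).resolve_left hj with h | h
    · rw [mem_decode, mem_decode, beq_iff_eq.1 h]
    · exact Bool.noConfusion (hp.symm.trans h)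
  -- The test only inspects pairs with `j < i`; the other order follows by symmetry of adjacency.
  have hS2 : ∀ i j, i ∉ decode L → j ∉ decode L → i ≠ j →
      decodeFamily p (insert j (insert i (decode L))) → (i ∈ decode S ↔ j ∈ decode S) := by
    intro i j hi hj hij hp
    rcases hij.lt_or_gt with h | h
    · rw [Finset.insert_comm] at hp
      exact (key j i hj hi h hp).symm
    · exact key i j hi hj h hp
  rcases h (decode S) (fun i hi => (h1 i).1 (hSV hi)) hS2 with h | ⟨h3, h4⟩
  · rw [← decode_zero] at h
    apply hS0
    rw [decode_injOn hS (by norm_num) h]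
    rfl
  · exact hVS h3 fun j hj => h4 j ((h1 j).1 hj).1 ((h1 j).1 hj).2

theorem hasVertices_eq_true {p t : ℕ} (ht : t ∈ Finset.Icc 1 3)
    (h : HasVertices (decodeFamily p) t) : hasVertices t p = true := by
  rw [Finset.mem_Icc] at ht
  by_contra hc
  simp only [hasVertices, Bool.or_eq_true, not_or, Bool.not_eq_true', Bool.not_eq_false,
    List.all_eq_true, not_forall, allBelow_eq_true] at hc
  obtain ⟨h0, E, hE, hc⟩ := hc
  obtain ⟨hE16, hEt⟩ := layer_spec (by omega) hE
  obtain ⟨j, hj, hp⟩ := h (by rwa [← decode_zero, decodeFamily_decode (by norm_num)]) (decode E)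
    (by omega)
  rw [← insert_empty_eq j, ← decode_zero, ← decode_insert,
    decodeFamily_decode (insert_code_lt (by norm_num) j)] at hp
  have hz : Nat.lor 0 (Nat.shiftLeft 1 j) = Nat.shiftLeft 1 j := Nat.zero_or _
  rw [hz] at hp
  rw [mem_decode] at hj
  rcases hc j j.2 with h1 | h1
  · exact hj h1
  · exact Bool.noConfusion (hp.symm.trans h1)

theorem pairsLeTriples_eq_true {p : ℕ} (h : PairsLeTriples (decodeFamily p)) :
    pairsLeTriples p = true := by
  by_contra hc
  simp only [pairsLeTriples, Bool.or_eq_true, not_or, Bool.not_eq_true', Bool.not_eq_false,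
    List.all_eq_true, Nat.ble_eq] at hc
  obtain ⟨h0, h1, h2⟩ := hc
  refine h2 ?_
  have := h (by rwa [← decode_zero, decodeFamily_decode (by norm_num)]) (by
    intro i
    rw [← insert_empty_eq i, ← decode_zero, ← decode_insert,
      decodeFamily_decode (insert_code_lt (by norm_num) i), Bool.not_eq_true]
    exact h1 _ (by revert i; decide))
  have e3 : ({0, 1} : Finset (Fin 4)) = decode 3 := by decide
  have e5 : ({0, 2} : Finset (Fin 4)) = decode 5 := by decide
  have e6 : ({1, 2} : Finset (Fin 4)) = decode 6 := by decide
  have e9 : ({0, 3} : Finset (Fin 4)) = decode 9 := by decide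
  have e10 : ({1, 3} : Finset (Fin 4)) = decode 10 := by decide
  have e12 : ({2, 3} : Finset (Fin 4)) = decode 12 := by decide
  have e7 : (insert 0 (decode 6)) = decode 7 := by decide
  have e11 : (insert 0 (decode 10)) = decode 11 := by decide
  have e13 : (insert 0 (decode 12)) = decode 13 := by decide
  have e14 : (insert 1 (decode 12)) = decode 14 := by decide
  -- Both cardinalities become sums of indicators over all tuples, of which only the six increasing
  -- pairs and the four increasing triples survive.
  simp only [Finset.card_filter, Fintype.sum_prod_type, Fin.sum_univ_four] at this
  simp (decide := true) only [e3, e5, e6, e9, e10, e12, e7, e11, e13, e14, decodeFamily_decode,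
    true_and, false_and, if_false, add_zero, zero_add] at this
  change List.countP (bit p) [3, 5, 6, 9, 10, 12] ≤ List.countP (bit p) [7, 11, 13, 14]
  simp only [List.countP_cons, List.countP_nil]
  omega

theorem isConvexCode_eq_true {p : ℕ} (h : ∀ A B C, decodeFamily p A → decodeFamily p B →
    A ⊆ C → C ⊆ B → decodeFamily p C) : isConvexCode p = true := by
  have key : ∀ x ∈ convexPairs, ∃ A < 16, ∃ B < 16, sub A B = true ∧ bit x.1 A = true ∧
      bit x.1 B = true ∧ x.2 = intervalCode A B ∧ x.2 < 2 ^ 16 := by decide +kernel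
  simp only [isConvexCode, List.all_eq_true, Bool.or_eq_true, Bool.not_eq_true']
  intro x hx
  obtain ⟨A, hA, B, hB, hAB, h1, h2, h3, h4⟩ := key x hx
  rw [← Bool.not_eq_true, sub_iff, sub_iff, or_iff_not_imp_left, not_not]
  intro hp C hC
  have hC16 : C < 16 := by
    by_contra hge
    rw [bit_eq_testBit, Nat.testBit_eq_false_of_lt
      (h4.trans_le (Nat.pow_le_pow_right (by norm_num) (not_lt.1 hge)))] at hC
    simp at hC
  rw [h3, bit_intervalCode hA hB hC16 hAB, Bool.and_eq_true, sub_iff_decode hA,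
    sub_iff_decode hC16] at hC
  rw [← decodeFamily_decode hC16]
  exact h _ _ _ ((decodeFamily_decode hA).2 (hp A h1)) ((decodeFamily_decode hB).2 (hp B h2))
    hC.1 hC.2

theorem isConvexCode_of_bit {p : ℕ} (h : ∀ A B C, A < 16 → B < 16 → C < 16 → bit p A = true →
    bit p B = true → sub A C = true → sub C B = true → bit p C = true) :
    isConvexCode p = true := by
  refine isConvexCode_eq_true fun A B C hA hB hAC hCB => ?_
  obtain ⟨A, hA16, rfl, hA⟩ := hA
  obtain ⟨B, hB16, rfl, hB⟩ := hB
  obtain ⟨C, hC, rfl⟩ := exists_decode C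
  exact (decodeFamily_decode hC).2 <| h A B C hA16 hB16 hC hA hB ((sub_iff_decode hA16).2 hAC)
    ((sub_iff_decode hC).2 hCB)

theorem le_of_sub {A B : ℕ} (h : sub A B = true) : A ≤ B := by
  have : A &&& B = A := Nat.eq_of_beq_eq_true h
  exact this ▸ Nat.and_le_right

theorem partitionTest_of_isConvex {p : ℕ} (hp : p < 2 ^ 15)
    (h : ∀ A B C, decodeFamily p A → decodeFamily p B → A ⊆ C → C ⊆ B → decodeFamily p C) :
    partitionTest p = true := by
  have hc : ∀ A B C, A < 16 → B < 16 → C < 16 → bit p A = true →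
      bit p B = true → sub A C = true → sub C B = true → bit p C = true := by
    intro A B C hA hB hC h1 h2 h3 h4
    exact (decodeFamily_decode hC).1 <| h _ _ _ ((decodeFamily_decode hA).2 h1)
      ((decodeFamily_decode hB).2 h2) ((sub_iff_decode hA).1 h3) ((sub_iff_decode hC).1 h4)
  have ha : p >>> 8 < 128 := by rw [Nat.shiftRight_eq_div_pow]; omega
  have hb : p % 2 ^ 8 < 256 := Nat.mod_lt _ (by norm_num)
  have hab : p >>> 8 <<< 8 ||| p % 2 ^ 8 = p := by
    refine Nat.eq_of_testBit_eq fun i => ?_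
    rw [Nat.testBit_or, Nat.testBit_shiftLeft, Nat.testBit_shiftRight, Nat.testBit_mod_two_pow]
    by_cases hi : i < 8
    · simp [hi, not_le.2 hi]
    · simp [hi, not_lt.1 hi]
  -- For `A < 8`, the code `8 + A` is that of the set of `A` with the element 3 adjoined.
  have bita (A : ℕ) : bit (p >>> 8) A = bit p (8 + A) := by
    rw [bit_eq_testBit, bit_eq_testBit, Nat.testBit_shiftRight]
  have bitb (A : ℕ) : bit (p % 2 ^ 8) A = true ↔ A < 8 ∧ bit p A = true := by
    rw [bit_eq_testBit, bit_eq_testBit, Nat.testBit_mod_two_pow, Bool.and_eq_true,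
      decide_eq_true_iff]
  have lt8 {A : ℕ} (hA : bit p (8 + A) = true) : A < 8 := by
    by_contra h8
    rw [bit_eq_testBit, Nat.testBit_eq_false_of_lt
      (hp.trans_le (Nat.pow_le_pow_right (by norm_num) (by omega)))] at hA
    exact Bool.noConfusion hA
  have sub8 : ∀ A < 8, ∀ B < 8, sub A B = true → sub (8 + A) (8 + B) = true := by decide
  have h1 := allBelow_eq_true.1 partitionTest_eq_true _ ha
  rw [isConvexCode_of_bit, Bool.not_true, Bool.false_or] at h1
  · have h2 := allBelow_eq_true.1 h1 _ hb
    rw [isConvexCode_of_bit, Bool.not_true, Bool.false_or, force_eq, hab, isConvexCode_of_bit hc,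
      Bool.not_true, Bool.false_or] at h2
    · exact h2
    · intro A B C hA hB hC h1 h2 h3 h4
      rw [bitb] at h1 h2 ⊢
      exact ⟨(le_of_sub h4).trans_lt h2.1, hc A B C hA hB hC h1.2 h2.2 h3 h4⟩
  · intro A B C _ _ _ h1 h2 h3 h4
    rw [bita] at h1 h2 ⊢
    have hA := lt8 h1
    have hB := lt8 h2
    have hC := (le_of_sub h4).trans_lt hB
    exact hc _ _ _ (by omega) (by omega) (by omega) h1 h2 (sub8 _ hA _ hC h3) (sub8 _ hC _ hB h4)

theorem exists_decodeFamily_eq (Q : Finset (Fin 4) → Prop) (hQ : ¬ Q Finset.univ) :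
    ∃ p < 2 ^ 15, decodeFamily p = Q := by
  classical
  -- Fifteen bits suffice, since code 15 is the full set, excluded by `hQ`.
  refine ⟨Nat.ofBits fun A : Fin 15 => decide (Q (decode A)), Nat.ofBits_lt_two_pow _, ?_⟩
  ext C
  obtain ⟨C, hC, rfl⟩ := exists_decode C
  rw [decodeFamily_decode hC, bit_eq_testBit]
  by_cases h : C < 15
  · rw [Nat.testBit_ofBits_lt _ _ h]
    simp
  · rw [Nat.testBit_ofBits_ge _ _ (not_lt.1 h)]
    obtain rfl : C = 15 := by omega
    have : decode 15 = Finset.univ := by decide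
    simpa [this] using hQ

/-- Convex families of proper subsets of `{0, 1, 2, 3}` satisfying the combinatorial consequences of
depth at least `t` have a partition into intervals whose tops have at least `t` elements. -/
theorem exists_isIntervalPartition {Q : Finset (Fin 4) → Prop} {t : ℕ} (ht : t ∈ Finset.Icc 1 3)
    (hQ : ¬ Q Finset.univ) (hconv : ∀ A B C, Q A → Q B → A ⊆ C → C ⊆ B → Q C)
    (h1 : HasVertices Q t) (h2 : 2 ≤ t → IsConnectedLink Q ∅)
    (h3 : 3 ≤ t → PairsLeTriples Q ∧ ∀ l, IsConnectedLink Q {l}) :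
    ∃ F, IsIntervalPartition Q t F := by
  obtain ⟨p, hp, rfl⟩ := exists_decodeFamily_eq Q hQ
  have hc := partitionTest_of_isConvex hp hconv
  have hv := hasVertices_eq_true ht h1
  have hl : 2 ≤ t → isConnectedLink p 0 = true := fun h =>
    isConnectedLink_eq_true (by norm_num) (decode_zero ▸ h2 h)
  have hd : depthTest t p = true := by
    obtain ⟨ht1, ht3⟩ := Finset.mem_Icc.1 ht
    interval_cases t
    · exact hv
    · rw [depthTest, hv, hl le_rfl]
      rfl
    · rw [depthTest, hv, hl (by norm_num), pairsLeTriples_eq_true (h3 le_rfl).1]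
      simp only [Bool.true_and]
      refine allBelow_eq_true.2 fun l hl => ?_
      have h4 : ∀ l < 4, Nat.shiftLeft 1 l < 16 := by decide
      refine isConnectedLink_eq_true (h4 l hl) ?_
      have h5 : ∀ l : Fin 4, decode (Nat.shiftLeft 1 l) = {l} := by decide
      rw [show decode (Nat.shiftLeft 1 l) = _ from h5 ⟨l, hl⟩]
      exact (h3 le_rfl).2 _
  obtain ⟨t, rfl⟩ : ∃ s, t = s + 1 := ⟨t - 1, by have := Finset.mem_Icc.1 ht; omega⟩
  rw [Finset.mem_Icc] at ht
  have := allBelow_eq_true.1 hc t (by omega)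
  rw [hd, Bool.not_true, Bool.or_false] at this
  exact exists_isIntervalPartition_of_hasPartition (by omega) this

end IntervalPartition

/-! ### Monomial classes and coefficient functionals on `J / I`. -/

section FactorModule

variable {K σ : Type*} [Field K] {I J : Ideal (MvPolynomial σ K)}

theorem monomial_mem_span_monomial_image {s : Set (σ →₀ ℕ)} {a : σ →₀ ℕ} :
    monomial a (1 : K) ∈ Ideal.span ((fun b : σ →₀ ℕ => monomial b (1 : K)) '' s) ↔
      ∃ c ∈ s, c ≤ a := by
  classical
  simp [mem_ideal_span_monomial_image, support_monomial]

/-- A squarefree generator divides a monomial as soon as its variables occur there. This is what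
reduces `J / I` to a family of finite sets. -/
theorem IsSquarefreeMonomialIdeal.monomial_mem (hI : IsSquarefreeMonomialIdeal I) {a b : σ →₀ ℕ}
    (hab : a.support ⊆ b.support) (ha : monomial a (1 : K) ∈ I) : monomial b (1 : K) ∈ I := by
  obtain ⟨s, hs, rfl⟩ := hI
  rw [monomial_mem_span_monomial_image] at ha ⊢
  obtain ⟨c, hc, hca⟩ := ha
  refine ⟨c, hc, fun i => ?_⟩
  by_cases hi : c i = 0
  · simp [hi]
  · have h1 : i ∈ a.support := by
      rw [Finsupp.mem_support_iff]
      exact ((Nat.pos_of_ne_zero hi).trans_le (hca i)).ne'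
    exact (hs c hc i).trans (Nat.one_le_iff_ne_zero.2 (Finsupp.mem_support_iff.1 (hab h1)))

theorem IsSquarefreeMonomialIdeal.mem_iff (hI : IsSquarefreeMonomialIdeal I)
    {f : MvPolynomial σ K} : f ∈ I ↔ ∀ a ∈ f.support, monomial a (1 : K) ∈ I := by
  obtain ⟨s, hs, rfl⟩ := hI
  rw [mem_ideal_span_monomial_image]
  simp only [monomial_mem_span_monomial_image]

theorem IsSquarefreeMonomialIdeal.coeff_eq_zero (hI : IsSquarefreeMonomialIdeal I)
    {f : MvPolynomial σ K} (hf : f ∈ I) {a : σ →₀ ℕ} (ha : monomial a (1 : K) ∉ I) :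
    coeff a f = 0 := by
  by_contra h
  exact ha (hI.mem_iff.1 hf a (mem_support_iff.2 h))

namespace FactorModule

open Classical in
/-- The class of the monomial `x^a` in `J / I`, if it belongs to `J`, and zero otherwise. -/
noncomputable def mon (I J : Ideal (MvPolynomial σ K)) (a : σ →₀ ℕ) : FactorModule I J :=
  if h : monomial a (1 : K) ∈ J then Submodule.Quotient.mk ⟨_, h⟩ else 0

open Classical in
/-- The coefficient of `x^a` as a function on `J / I`, if it is well defined, and zero otherwise. -/
noncomputable def cf (I J : Ideal (MvPolynomial σ K)) (a : σ →₀ ℕ) : FactorModule I J →ₗ[K] K :=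
  if h : ∀ f ∈ I, coeff a f = 0 then
    ((Submodule.submoduleOf I J).restrictScalars K).liftQ
      ((lcoeff K a).comp ((Submodule.subtype J).restrictScalars K)) (fun f hf => h f hf) ∘ₗ
      (Submodule.Quotient.restrictScalarsEquiv K (Submodule.submoduleOf I J)).symm.toLinearMap
  else 0

theorem cf_mk (hI : IsSquarefreeMonomialIdeal I) {a : σ →₀ ℕ} (ha : monomial a (1 : K) ∉ I)
    (f : J) : cf I J a (Submodule.Quotient.mk f) = coeff a (f : MvPolynomial σ K) := by
  rw [cf, dif_pos fun f hf => hI.coeff_eq_zero hf ha]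
  rfl

theorem cf_eq_zero (hI : IsSquarefreeMonomialIdeal I) (hJ : IsSquarefreeMonomialIdeal J)
    {a : σ →₀ ℕ} (hI' : monomial a (1 : K) ∉ I) (ha : monomial a (1 : K) ∉ J)
    (u : FactorModule I J) : cf I J a u = 0 := by
  obtain ⟨f, rfl⟩ := Submodule.Quotient.mk_surjective _ u
  rw [cf_mk hI hI', hJ.coeff_eq_zero f.2 ha]

theorem mon_of_mem {a : σ →₀ ℕ} (ha : monomial a (1 : K) ∈ J) :
    mon I J a = Submodule.Quotient.mk ⟨_, ha⟩ := dif_pos ha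

theorem mon_of_notMem {a : σ →₀ ℕ} (ha : monomial a (1 : K) ∉ J) : mon I J a = 0 := dif_neg ha

theorem mon_eq_zero {a : σ →₀ ℕ} (ha : monomial a (1 : K) ∈ J → monomial a (1 : K) ∈ I) :
    mon I J a = 0 := by
  by_cases h : monomial a (1 : K) ∈ J
  · rw [mon_of_mem h, Submodule.Quotient.mk_eq_zero]
    exact ha h
  · exact mon_of_notMem h

theorem cf_mon [DecidableEq σ] (hI : IsSquarefreeMonomialIdeal I) {a b : σ →₀ ℕ}
    (ha : monomial a (1 : K) ∉ I) (hb : monomial b (1 : K) ∈ J) :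
    cf I J a (mon I J b) = if b = a then 1 else 0 := by
  rw [mon_of_mem hb, cf_mk hI ha, coeff_monomial]

theorem monomial_smul_mon {a b : σ →₀ ℕ} (ha : monomial a (1 : K) ∈ J) :
    (monomial b (1 : K) : MvPolynomial σ K) • mon I J a = mon I J (a + b) := by
  have hab : monomial (a + b) (1 : K) ∈ J := by
    rw [add_comm, ← one_mul (1 : K), ← monomial_mul]
    exact J.mul_mem_left _ ha
  rw [mon_of_mem ha, mon_of_mem hab, ← Submodule.Quotient.mk_smul]
  congr 1
  ext1
  simp [monomial_mul, add_comm]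

theorem X_smul_mon {a : σ →₀ ℕ} (ha : monomial a (1 : K) ∈ J) (i : σ) :
    (X i : MvPolynomial σ K) • mon I J a = mon I J (a + Finsupp.single i 1) :=
  monomial_smul_mon ha

theorem cf_X_smul (hI : IsSquarefreeMonomialIdeal I) {a : σ →₀ ℕ} {i : σ}
    (ha : monomial (a + Finsupp.single i 1) (1 : K) ∉ I) (u : FactorModule I J) :
    cf I J (a + Finsupp.single i 1) ((X i : MvPolynomial σ K) • u) = cf I J a u := by
  have ha' : monomial a (1 : K) ∉ I := fun h => ha <| by
    rw [add_comm, ← one_mul (1 : K), ← monomial_mul]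
    exact I.mul_mem_left _ h
  obtain ⟨f, rfl⟩ := Submodule.Quotient.mk_surjective _ u
  rw [← Submodule.Quotient.mk_smul, cf_mk hI ha, cf_mk hI ha']
  simp [add_comm a, coeff_X_mul]

theorem cf_X_smul_of_eq_zero (hI : IsSquarefreeMonomialIdeal I) {a : σ →₀ ℕ} {i : σ}
    (ha : monomial a (1 : K) ∉ I) (hi : a i = 0) (u : FactorModule I J) :
    cf I J a ((X i : MvPolynomial σ K) • u) = 0 := by
  classical
  obtain ⟨f, rfl⟩ := Submodule.Quotient.mk_surjective _ u
  rw [← Submodule.Quotient.mk_smul, cf_mk hI ha]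
  simp [coeff_X_mul', hi]

theorem eq_zero_of_cf (hI : IsSquarefreeMonomialIdeal I) (hJ : IsSquarefreeMonomialIdeal J)
    {u : FactorModule I J} (hu : ∀ a, monomial a (1 : K) ∈ J → monomial a (1 : K) ∉ I →
      cf I J a u = 0) : u = 0 := by
  obtain ⟨f, rfl⟩ := Submodule.Quotient.mk_surjective _ u
  rw [Submodule.Quotient.mk_eq_zero]
  refine hI.mem_iff.2 fun a ha => ?_
  by_contra h
  have := hu a (hJ.mem_iff.1 f.2 a ha) h
  rw [cf_mk hI h] at this
  exact mem_support_iff.1 ha this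

theorem mem_of_mon_mem (hJ : IsSquarefreeMonomialIdeal J) {V : Submodule K (FactorModule I J)}
    (h : ∀ a, monomial a (1 : K) ∈ J → monomial a (1 : K) ∉ I → mon I J a ∈ V)
    (u : FactorModule I J) : u ∈ V := by
  classical
  obtain ⟨f, rfl⟩ := Submodule.Quotient.mk_surjective _ u
  have hf : f = ∑ a ∈ f.1.support.attach, coeff a.1 f.1 •
      (⟨monomial a.1 1, hJ.mem_iff.1 f.2 a.1 a.2⟩ : J) := by
    ext1
    rw [Submodule.coe_sum]
    simp only [Submodule.coe_smul_of_tower, smul_monomial, smul_eq_mul, mul_one]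
    rw [Finset.sum_attach f.1.support fun a => monomial a (coeff a f.1)]
    exact f.1.as_sum
  rw [hf, ← Submodule.mkQ_apply, map_sum]
  refine V.sum_mem fun a _ => ?_
  have : Submodule.mkQ (Submodule.submoduleOf I J) (coeff a.1 f.1 •
      (⟨monomial a.1 1, hJ.mem_iff.1 f.2 a.1 a.2⟩ : J)) = coeff a.1 f.1 • mon I J a := by
    rw [mon_of_mem (hJ.mem_iff.1 f.2 a.1 a.2)]
    rfl
  rw [this]
  refine V.smul_mem _ ?_
  by_cases hI : monomial a.1 (1 : K) ∈ I
  · rw [mon_eq_zero fun _ => hI]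
    exact V.zero_mem
  · exact h a (hJ.mem_iff.1 f.2 a.1 a.2) hI

end FactorModule

end FactorModule

/-! ### From interval partitions to Stanley decompositions. -/

section FactorModule

variable {K σ : Type*} [Field K] {I J : Ideal (MvPolynomial σ K)}

/-- The exponent of the squarefree monomial with a given set of variables. -/
noncomputable def sqfreeExp (A : Finset σ) : σ →₀ ℕ := Finsupp.indicator A fun _ _ => 1

theorem sqfreeExp_apply [DecidableEq σ] (A : Finset σ) (i : σ) :
    sqfreeExp A i = if i ∈ A then 1 else 0 := by
  rw [sqfreeExp, Finsupp.indicator_apply]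
  split_ifs <;> rfl

@[simp] theorem support_sqfreeExp (A : Finset σ) : (sqfreeExp A).support = A := by
  classical
  ext i
  simp [sqfreeExp_apply]

theorem sqfreeExp_le_iff {A : Finset σ} {a : σ →₀ ℕ} : sqfreeExp A ≤ a ↔ A ⊆ a.support := by
  classical
  constructor
  · intro h i hi
    have := h i
    rw [sqfreeExp_apply, if_pos hi] at this
    exact Finsupp.mem_support_iff.2 (Nat.one_le_iff_ne_zero.1 this)
  · intro h i
    rw [sqfreeExp_apply]
    split_ifs with hi
    · exact Nat.one_le_iff_ne_zero.2 (Finsupp.mem_support_iff.1 (h hi))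
    · exact Nat.zero_le _

/-- The sets of variables of the squarefree monomials in `J` but not in `I`. -/
def sqfreeFamily (I J : Ideal (MvPolynomial σ K)) (A : Finset σ) : Prop :=
  monomial (sqfreeExp A) (1 : K) ∈ J ∧ monomial (sqfreeExp A) (1 : K) ∉ I

theorem IsSquarefreeMonomialIdeal.monomial_mem_iff (hI : IsSquarefreeMonomialIdeal I)
    {a : σ →₀ ℕ} : monomial a (1 : K) ∈ I ↔ monomial (sqfreeExp a.support) (1 : K) ∈ I :=
  ⟨hI.monomial_mem (by simp), hI.monomial_mem (by simp)⟩

theorem sqfreeFamily_support_iff (hI : IsSquarefreeMonomialIdeal I)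
    (hJ : IsSquarefreeMonomialIdeal J) {a : σ →₀ ℕ} :
    sqfreeFamily I J a.support ↔ monomial a (1 : K) ∈ J ∧ monomial a (1 : K) ∉ I := by
  rw [sqfreeFamily, ← hI.monomial_mem_iff, ← hJ.monomial_mem_iff]

theorem sqfreeFamily.of_subset (hI : IsSquarefreeMonomialIdeal I)
    (hJ : IsSquarefreeMonomialIdeal J) {A B C : Finset σ} (hA : sqfreeFamily I J A)
    (hB : sqfreeFamily I J B) (hAC : A ⊆ C) (hCB : C ⊆ B) : sqfreeFamily I J C :=
  ⟨hJ.monomial_mem (by simpa using hAC) hA.1, fun h => hB.2 (hI.monomial_mem (by simpa using hCB) h)⟩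

/-- With trivial annihilator, multiplication f ↦ f m identifies K[B] with the Stanley space. -/
theorem free_stanleySpace {M : Type*} [AddCommGroup M] [Module (MvPolynomial σ K) M] {m : M}
    {B : Finset σ} (h : ∀ f ∈ supported K (B : Set σ), f • m = 0 → f = 0) :
    Module.Free (supported K (B : Set σ)) (stanleySpace K m B) := by
  have hinj : Function.Injective (LinearMap.toSpanSingleton (supported K (B : Set σ)) M m) := by
    rw [injective_iff_map_eq_zero]
    rintro ⟨f, hf⟩ hfm
    exact Subtype.ext (h f hf hfm)
  refine Module.Free.of_equiv ((LinearEquiv.ofInjective _ hinj).trans (LinearEquiv.ofEq _ _ ?_))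
  rw [LinearMap.range_toSpanSingleton]
  rfl

namespace FactorModule

open Classical in
theorem cf_smul_mon (hI : IsSquarefreeMonomialIdeal I) {a b : σ →₀ ℕ}
    (ha : monomial a (1 : K) ∉ I) (hb : monomial b (1 : K) ∈ J) (f : MvPolynomial σ K) :
    cf I J a (f • mon I J b) = if b ≤ a then coeff (a - b) f else 0 := by
  rw [mon_of_mem hb, ← Submodule.Quotient.mk_smul, cf_mk hI ha]
  simp [coeff_mul_monomial']

variable {A B : Finset σ}

theorem mem_interval_of_cf_ne_zero (hI : IsSquarefreeMonomialIdeal I) (hAB : A ⊆ B)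
    (hA : sqfreeFamily I J A) {u : FactorModule I J}
    (hu : u ∈ (stanleySpace K (mon I J (sqfreeExp A)) B).restrictScalars K)
    {a : σ →₀ ℕ} (ha : monomial a (1 : K) ∉ I) (h : cf I J a u ≠ 0) :
    A ⊆ a.support ∧ a.support ⊆ B := by
  classical
  rw [Submodule.restrictScalars_mem, stanleySpace, Submodule.mem_span_singleton] at hu
  obtain ⟨⟨f, hf⟩, rfl⟩ := hu
  rw [Subalgebra.smul_def, cf_smul_mon hI ha hA.1] at h
  split_ifs at h with hle
  · refine ⟨sqfreeExp_le_iff.1 hle, fun i hi => ?_⟩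
    by_cases hiA : i ∈ A
    · exact hAB hiA
    · refine mem_supported.1 hf ((mem_vars_iff_mem_support i).2 ⟨_, mem_support_iff.2 h, ?_⟩)
      rw [Finsupp.mem_support_iff] at hi ⊢
      rwa [Finsupp.tsub_apply, sqfreeExp_apply, if_neg hiA, tsub_zero]
  · exact absurd rfl h

theorem mon_mem_stanleySpace (hA : sqfreeFamily I J A) {a : σ →₀ ℕ} (h1 : A ⊆ a.support)
    (h2 : a.support ⊆ B) :
    mon I J a ∈ (stanleySpace K (mon I J (sqfreeExp A)) B).restrictScalars K := by
  classical
  rw [Submodule.restrictScalars_mem, stanleySpace, Submodule.mem_span_singleton]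
  refine ⟨⟨monomial (a - sqfreeExp A) 1, mem_supported.2 ?_⟩, ?_⟩
  · intro i hi
    rw [vars_monomial one_ne_zero] at hi
    exact h2 (Finsupp.support_tsub hi)
  · rw [Subalgebra.smul_def, monomial_smul_mon hA.1, add_tsub_cancel_of_le (sqfreeExp_le_iff.2 h1)]

/-- For x^c in K[B], the support of x_A x^c lies between A and B, so this monomial survives modulo I
and its coefficient recovers that of x^c in f. -/
theorem eq_zero_of_smul_mon_eq_zero (hI : IsSquarefreeMonomialIdeal I)
    (hJ : IsSquarefreeMonomialIdeal J) (hAB : A ⊆ B)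
    (hQ : ∀ C, A ⊆ C → C ⊆ B → sqfreeFamily I J C) {f : MvPolynomial σ K}
    (hf : f ∈ supported K (B : Set σ)) (h : f • mon I J (sqfreeExp A) = 0) : f = 0 := by
  classical
  refine MvPolynomial.ext _ _ fun c => ?_
  by_contra hc
  have hsupp : (sqfreeExp A + c).support = A ∪ c.support := by
    ext i
    simp only [Finsupp.mem_support_iff, Finsupp.add_apply, sqfreeExp_apply, Finset.mem_union]
    split_ifs <;> simp_all
  have hcB : c.support ⊆ B := fun i hi =>
    mem_supported.1 hf ((mem_vars_iff_mem_support i).2 ⟨c, mem_support_iff.2 hc, hi⟩)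
  have h1 := (sqfreeFamily_support_iff hI hJ).1 (hQ (sqfreeExp A + c).support
    (hsupp ▸ Finset.subset_union_left) (hsupp ▸ Finset.union_subset hAB hcB))
  have h2 := congrArg (cf I J (sqfreeExp A + c)) h
  rw [cf_smul_mon hI h1.2 (hQ A subset_rfl hAB).1, if_pos le_self_add, add_tsub_cancel_left,
    map_zero] at h2
  exact hc h2

end FactorModule

/-- A partition of the sets of squarefree monomials in `J` and not in `I` into intervals gives a
Stanley decomposition of `J / I`. -/
theorem IsIntervalPartition.le_stanleyDepth {I J : Ideal (MvPolynomial (Fin 4) K)}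
    (hI : IsSquarefreeMonomialIdeal I) (hJ : IsSquarefreeMonomialIdeal J) {t : ℕ}
    {F : Finset (Finset (Fin 4) × Finset (Fin 4))}
    (hF : IsIntervalPartition (sqfreeFamily I J) t F) :
    (t : ℕ∞) ≤ stanleyDepth (Fin 4) (FactorModule.component I J) := by
  have hbot : ∀ x ∈ F, sqfreeFamily I J x.1 := fun x hx =>
    hF.mem x hx _ subset_rfl (hF.subset x hx)
  let e := F.equivFin.symm
  let D : StanleyDecomposition (σ := Fin 4) (FactorModule.component I J) :=
    { r := F.card
      m := fun i => FactorModule.mon I J (sqfreeExp (e i).1.1)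
      Z := fun i => (e i).1.2
      homogeneous := fun i => ⟨sqfreeExp (e i).1.1, by
        have h := (hbot _ (e i).2).1
        rw [FactorModule.mon_of_mem h]
        exact ⟨⟨_, h⟩, Submodule.mem_span_singleton_self _, rfl⟩⟩
      ne_zero := fun i h => by
        have h1 := hbot _ (e i).2
        have := congrArg (FactorModule.cf I J (sqfreeExp (e i).1.1)) h
        rw [FactorModule.cf_mon hI h1.2 h1.1, if_pos rfl, map_zero] at this
        exact one_ne_zero this
      free := fun i => free_stanleySpace fun _ hf h =>
        FactorModule.eq_zero_of_smul_mon_eq_zero hI hJ (hF.subset _ (e i).2) (hF.mem _ (e i).2) hf h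
      isInternal := by
        refine DirectSum.isInternal_submodule_of_iSupIndep_of_iSup_eq_top ?_ ?_
        · intro i
          -- The common kernel of the coefficients belonging to the i-th interval. The other Stanley
          -- spaces lie in it because the intervals are disjoint, while an element of the i-th space
          -- has no other coefficients.
          let W : Submodule K (FactorModule I J) :=
            ⨅ a : {a : Fin 4 →₀ ℕ // monomial a (1 : K) ∉ I ∧ (e i).1.1 ⊆ a.support ∧
              a.support ⊆ (e i).1.2}, LinearMap.ker (FactorModule.cf I J a.1)
          have hW : ⨆ j, ⨆ _ : j ≠ i, (stanleySpace K (FactorModule.mon I J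
              (sqfreeExp (e j).1.1)) (e j).1.2).restrictScalars K ≤ W := by
            refine iSup₂_le fun j hj u hu => ?_
            refine (Submodule.mem_iInf _).2 fun ⟨a, ha, h1, h2⟩ => ?_
            rw [LinearMap.mem_ker]
            by_contra h
            have h3 := FactorModule.mem_interval_of_cf_ne_zero hI (hF.subset _ (e j).2)
              (hbot _ (e j).2) hu ha h
            exact hj (e.injective (Subtype.ext
              (hF.eq_of_mem _ (e j).2 _ (e i).2 a.support h3.1 h3.2 h1 h2)))
          rw [Submodule.disjoint_def]
          intro u hu hu'
          refine FactorModule.eq_zero_of_cf hI hJ fun a _ ha => ?_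
          by_contra h
          have h3 := FactorModule.mem_interval_of_cf_ne_zero hI (hF.subset _ (e i).2)
              (hbot _ (e i).2) hu ha h
          exact h ((Submodule.mem_iInf _).1 (hW hu') ⟨a, ha, h3⟩)
        · refine eq_top_iff.2 fun u _ => FactorModule.mem_of_mon_mem hJ (fun a haJ haI => ?_) u
          obtain ⟨x, hx, h1, h2⟩ := hF.exists_mem _ ((sqfreeFamily_support_iff hI hJ).2 ⟨haJ, haI⟩)
          refine Submodule.mem_iSup_of_mem (e.symm ⟨x, hx⟩) ?_
          rw [Equiv.apply_symm_apply]
          exact FactorModule.mon_mem_stanleySpace (hbot x hx) h1 h2 }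
  refine le_trans ?_ (le_iSup _ D)
  exact le_iInf fun i => Nat.cast_le.2 (hF.le_card _ (e i).2)

end FactorModule

/-! ### From Koszul vanishing to conditions on the family. -/

section FactorModule

variable {K : Type*} [Field K] {I J : Ideal (MvPolynomial (Fin 4) K)}

theorem sqfreeExp_insert {σ : Type*} [DecidableEq σ] {A : Finset σ} {i : σ} (hi : i ∉ A) :
    sqfreeExp (insert i A) = sqfreeExp A + Finsupp.single i 1 := by
  ext j
  rw [Finsupp.add_apply, sqfreeExp_apply, sqfreeExp_apply, Finsupp.single_apply]
  by_cases h : i = j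
  · subst h
    simp [hi]
  · simp [h, Ne.symm h]

theorem IsSquarefreeMonomialIdeal.sqfreeExp_notMem (hI : IsSquarefreeMonomialIdeal I)
    {A B : Finset (Fin 4)} (hB : sqfreeFamily I J B) (hAB : A ⊆ B) :
    monomial (sqfreeExp A) (1 : K) ∉ I :=
  fun h => hB.2 (hI.monomial_mem (by simpa using hAB) h)

namespace FactorModule

/-- The class of a squarefree monomial in `J / I`. -/
noncomputable def sqMon (I J : Ideal (MvPolynomial (Fin 4) K)) (A : Finset (Fin 4)) :
    FactorModule I J := mon I J (sqfreeExp A)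

/-- The coefficient of a squarefree monomial, on `J / I`. -/
noncomputable def sqCf (I J : Ideal (MvPolynomial (Fin 4) K)) (A : Finset (Fin 4)) :
    FactorModule I J →ₗ[K] K := cf I J (sqfreeExp A)

variable {A B : Finset (Fin 4)} {i : Fin 4}

theorem sqMon_eq_zero (h : ¬ sqfreeFamily I J A) : sqMon I J A = 0 :=
  mon_eq_zero fun hJ => by_contra fun hI => h ⟨hJ, hI⟩

theorem X_smul_sqMon (hA : monomial (sqfreeExp A) (1 : K) ∈ J) (hi : i ∉ A) :
    (X i : MvPolynomial (Fin 4) K) • sqMon I J A = sqMon I J (insert i A) := by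
  rw [sqMon, X_smul_mon hA, ← sqfreeExp_insert hi, sqMon]

theorem sqCf_sqMon (hI : IsSquarefreeMonomialIdeal I) (hA : sqfreeFamily I J A) :
    sqCf I J A (sqMon I J A) = 1 := by
  rw [sqCf, sqMon, cf_mon hI hA.2 hA.1, if_pos rfl]

theorem sqCf_X_smul (hI : IsSquarefreeMonomialIdeal I) (hi : i ∉ A)
    (hA : sqfreeFamily I J (insert i A)) (u : FactorModule I J) :
    sqCf I J (insert i A) ((X i : MvPolynomial (Fin 4) K) • u) = sqCf I J A u := by
  have h := hA.2
  rw [sqfreeExp_insert hi] at h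
  rw [sqCf, sqfreeExp_insert hi, cf_X_smul hI h, sqCf]

theorem sqCf_X_smul_of_notMem (hI : IsSquarefreeMonomialIdeal I) (hi : i ∉ A)
    (hA : sqfreeFamily I J A) (u : FactorModule I J) :
    sqCf I J A ((X i : MvPolynomial (Fin 4) K) • u) = 0 :=
  cf_X_smul_of_eq_zero hI hA.2 (by rw [sqfreeExp_apply, if_neg hi]) u

/-- Since x_B is not in I, neither is its divisor x_A; being outside the family then means that x_A
is not in J. -/
theorem sqCf_eq_zero (hI : IsSquarefreeMonomialIdeal I) (hJ : IsSquarefreeMonomialIdeal J)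
    (hB : sqfreeFamily I J B) (hAB : A ⊆ B) (hA : ¬ sqfreeFamily I J A) (u : FactorModule I J) :
    sqCf I J A u = 0 :=
  cf_eq_zero hI hJ (hI.sqfreeExp_notMem hB hAB)
    (fun h => hA ⟨h, hI.sqfreeExp_notMem hB hAB⟩) u

end FactorModule

open FactorModule

/-- Without vertices, the class of 1 would be a nonzero element killed by all variables. -/
theorem hasVertices_one (h0 : ∀ u : FactorModule I J,
    (∀ i, (X i : MvPolynomial (Fin 4) K) • u = 0) → u = 0) (hI : IsSquarefreeMonomialIdeal I) :
    HasVertices (sqfreeFamily I J) 1 := by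
  intro hQ E hE
  obtain rfl : E = ∅ := by simpa using hE
  by_contra! hc
  have := h0 (sqMon I J ∅) fun i => by
    rw [X_smul_sqMon hQ.1 (by simp), insert_empty_eq, sqMon_eq_zero (hc i (by simp))]
  have h1 := sqCf_sqMon hI hQ
  rw [this, map_zero] at h1
  exact zero_ne_one h1

section

variable (h1 : ∀ u : Fin 4 → FactorModule I J,
  (∀ i j, (X i : MvPolynomial (Fin 4) K) • u j = (X j : MvPolynomial (Fin 4) K) • u i) →
    ∃ v, ∀ i, u i = (X i : MvPolynomial (Fin 4) K) • v)
include h1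

/-- If `l` were the only possible vertex, the cochain with entry 1 at `l` and 0 elsewhere would be a
cocycle. It bounds nothing, since x_l v has constant coefficient 0. -/
theorem hasVertices_two (hI : IsSquarefreeMonomialIdeal I) :
    HasVertices (sqfreeFamily I J) 2 := by
  intro hQ E hE
  obtain ⟨E', hEE', hE'⟩ := Finset.exists_superset_card_eq (show E.card ≤ 1 by omega) (by simp)
  obtain ⟨l, rfl⟩ := Finset.card_eq_one.1 hE'
  by_contra! hc
  have hz : ∀ i, i ≠ l → (X i : MvPolynomial (Fin 4) K) • sqMon I J ∅ = 0 := fun i hi => by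
    rw [X_smul_sqMon hQ.1 (by simp), insert_empty_eq,
      sqMon_eq_zero (hc i fun h => hi (by simpa using hEE' h))]
  obtain ⟨v, hv⟩ := h1 (fun i => if i = l then sqMon I J ∅ else 0) fun i j => by
    by_cases hi : i = l <;> by_cases hj : j = l <;> simp [hi, hj, hz]
  have := congrArg (sqCf I J ∅) (hv l)
  rw [if_pos rfl, sqCf_sqMon hI hQ, sqCf_X_smul_of_notMem hI (by simp) hQ] at this
  exact one_ne_zero this

/-- The cochain x_i for i in S, 0 elsewhere, is a cocycle because no edge leaves S. If v bounds it,
the constant coefficient of v is 1 seen from a vertex in S and 0 seen from one outside; it is also 0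
if the empty set is not in the family. -/
theorem isConnectedLink_empty (hI : IsSquarefreeMonomialIdeal I)
    (hJ : IsSquarefreeMonomialIdeal J) : IsConnectedLink (sqfreeFamily I J) ∅ := by
  intro S hS hcl
  simp only [insert_empty_eq] at hS hcl
  obtain ⟨v, hv⟩ := h1 (fun i => if i ∈ S then sqMon I J {i} else 0) fun i j => by
    by_cases hij : i = j
    · rw [hij]
    have key : ∀ i j, i ≠ j → i ∈ S →
        (X j : MvPolynomial (Fin 4) K) • sqMon I J {i} = sqMon I J {j, i} := fun i j hij hi =>
      X_smul_sqMon (hS i hi).2.1 (by simpa using hij.symm)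
    have hz : ∀ i j, i ≠ j → i ∈ S → j ∉ S → sqMon I J {j, i} = 0 := fun i j hij hi hj =>
      sqMon_eq_zero fun h => hj ((hcl i j (by simp) (by simp) hij h).1 hi)
    by_cases hi : i ∈ S <;> by_cases hj : j ∈ S
    · simp only [hi, hj, if_true]
      rw [key i j hij hi, key j i (Ne.symm hij) hj, Finset.pair_comm]
    · simp only [hi, hj, if_true, if_false]
      rw [key i j hij hi, hz i j hij hi hj, smul_zero]
    · simp only [hi, hj, if_true, if_false]
      rw [key j i (Ne.symm hij) hj, hz j i (Ne.symm hij) hj hi, smul_zero]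
    · simp [hi, hj]
  have hc : ∀ j, sqfreeFamily I J {j} → sqCf I J ∅ v = if j ∈ S then 1 else 0 := fun j hj => by
    have h := congrArg (sqCf I J (insert j ∅)) (hv j)
    rw [sqCf_X_smul hI (by simp) (by rwa [insert_empty_eq])] at h
    rw [← h, insert_empty_eq]
    split_ifs
    · exact sqCf_sqMon hI hj
    · exact map_zero _
  rcases S.eq_empty_or_nonempty with hS0 | ⟨k, hk⟩
  · exact Or.inl hS0
  · have hk1 := hc k (hS k hk).2
    rw [if_pos hk] at hk1
    refine Or.inr ⟨?_, fun j _ hj => ?_⟩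
    · by_contra hQ
      rw [sqCf_eq_zero hI hJ (hS k hk).2 (by simp) hQ] at hk1
      exact zero_ne_one hk1
    · rw [insert_empty_eq] at hj
      by_contra hjS
      rw [hc j hj, if_neg hjS] at hk1
      exact zero_ne_one hk1

end

section

variable (h2 : ∀ u : Fin 4 → Fin 4 → FactorModule I J,
  (∀ i j l, (X i : MvPolynomial (Fin 4) K) • u j l - (X j : MvPolynomial (Fin 4) K) • u i l +
    (X l : MvPolynomial (Fin 4) K) • u i j = 0) →
    ∃ v : Fin 4 → FactorModule I J, ∀ i j,
      u i j = (X i : MvPolynomial (Fin 4) K) • v j - (X j : MvPolynomial (Fin 4) K) • v i)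
include h2

/-- A first Koszul cocycle away from the variable `x_l` extends to a second Koszul cocycle. -/
theorem exists_of_link_cocycle (l : Fin 4) {w : Fin 4 → FactorModule I J}
    (hw : ∀ i j, i ≠ l → j ≠ l →
      (X i : MvPolynomial (Fin 4) K) • w j = (X j : MvPolynomial (Fin 4) K) • w i) :
    ∃ v : Fin 4 → FactorModule I J,
      (∀ j, j ≠ l → w j = (X l : MvPolynomial (Fin 4) K) • v j -
        (X j : MvPolynomial (Fin 4) K) • v l) ∧
      ∀ i j, i ≠ l → j ≠ l →
        (X i : MvPolynomial (Fin 4) K) • v j = (X j : MvPolynomial (Fin 4) K) • v i := by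
  -- This is the exterior product of the basis covector at `l` with `w`.
  obtain ⟨v, hv⟩ := h2 (fun i j => (if i = l then w j else 0) - if j = l then w i else 0)
    fun i j k => by
      by_cases hi : i = l <;> by_cases hj : j = l <;> by_cases hk : k = l <;>
        simp [hi, hj, hk, hw]
  refine ⟨v, fun j hj => ?_, fun i j hi hj => ?_⟩
  · simpa [hj] using hv l j
  · simpa [hi, hj, eq_comm, sub_eq_zero] using hv i j

/-- If all vertices lay in {l, m}, the class of 1 placed in position (l, m) would be a 2-cocycle. It
is no coboundary, since x_l v_m - x_m v_l has constant coefficient 0. -/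
theorem hasVertices_three (hI : IsSquarefreeMonomialIdeal I) :
    HasVertices (sqfreeFamily I J) 3 := by
  intro hQ E hE
  obtain ⟨E', hEE', hE'⟩ := Finset.exists_superset_card_eq (show E.card ≤ 2 by omega) (by simp)
  obtain ⟨l, m, hlm, rfl⟩ := Finset.card_eq_two.1 hE'
  by_contra! hc
  have hz : ∀ i, i ≠ l → i ≠ m → (X i : MvPolynomial (Fin 4) K) • sqMon I J ∅ = 0 :=
    fun i hi hi' => by
      rw [X_smul_sqMon hQ.1 (by simp), insert_empty_eq, sqMon_eq_zero (hc i fun h => by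
        have := hEE' h
        simp [hi, hi'] at this)]
  obtain ⟨v, hv, -⟩ := exists_of_link_cocycle h2 l (w := fun i => if i = m then sqMon I J ∅ else 0)
    fun i j hi hj => by
      by_cases hi' : i = m <;> by_cases hj' : j = m <;> simp_all
  have := congrArg (sqCf I J ∅) (hv m hlm.symm)
  rw [if_pos rfl, sqCf_sqMon hI hQ, map_sub, sqCf_X_smul_of_notMem hI (by simp) hQ,
    sqCf_X_smul_of_notMem hI (by simp) hQ, sub_zero] at this
  exact one_ne_zero this

/-- Exactness is used twice. For the cocycle x_i x_l (i in S), a bounding v gives, in degree x_j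
x_l, the indicator of S at j as the x_j-coefficient of v_j minus the x_l-coefficient of v_l. The
first term could still vary with j; but these coefficients agree along edges, so they form a cocycle
themselves, and a second application shows that they are constant. -/
theorem isConnectedLink_singleton (hI : IsSquarefreeMonomialIdeal I)
    (hJ : IsSquarefreeMonomialIdeal J) (l : Fin 4) :
    IsConnectedLink (sqfreeFamily I J) {l} := by
  intro S hS hcl
  simp only [Finset.mem_singleton] at hS hcl
  have key : ∀ i j, i ≠ j → j ≠ l → i ∈ S →
      (X j : MvPolynomial (Fin 4) K) • sqMon I J {i, l} = sqMon I J {j, i, l} :=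
    fun i j hij hj hi => X_smul_sqMon (hS i hi).2.1 (by simp [hij.symm, hj])
  have hz : ∀ i j, i ≠ j → j ≠ l → i ∈ S → j ∉ S → sqMon I J {j, i, l} = 0 :=
    fun i j hij hj hi hjS => sqMon_eq_zero fun h =>
      hjS ((hcl i j (hS i hi).1 hj hij h).1 hi)
  obtain ⟨v, hv, hv'⟩ := exists_of_link_cocycle h2 l
    (w := fun i => if i ∈ S then sqMon I J {i, l} else 0) fun i j hi hj => by
      by_cases hij : i = j
      · rw [hij]
      by_cases hiS : i ∈ S <;> by_cases hjS : j ∈ S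
      · simp only [hiS, hjS, if_true]
        rw [key i j hij hj hiS, key j i (Ne.symm hij) hi hjS, Finset.insert_comm]
      · simp only [hiS, hjS, if_true, if_false]
        rw [key i j hij hj hiS, hz i j hij hj hiS hjS, smul_zero]
      · simp only [hiS, hjS, if_true, if_false]
        rw [key j i (Ne.symm hij) hi hjS, hz j i (Ne.symm hij) hi hjS hiS, smul_zero]
      · simp [hiS, hjS]
  have hb : ∀ i j, i ≠ j → i ≠ l → j ≠ l → sqfreeFamily I J {i, j} →
      sqCf I J {i} (v i) = sqCf I J {j} (v j) := fun i j hij hi hj hQ => by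
    have h := congrArg (sqCf I J {i, j}) (hv' i j hi hj)
    rw [sqCf_X_smul hI (by simpa using hij) hQ, Finset.pair_comm,
      sqCf_X_smul hI (by simpa using hij.symm) (by rwa [Finset.pair_comm])] at h
    exact h.symm
  have hX : ∀ i j, i ≠ j → (X i : MvPolynomial (Fin 4) K) • sqCf I J {j} (v j) • sqMon I J {j} =
      sqCf I J {j} (v j) • sqMon I J {i, j} := fun i j hij => by
    rw [smul_comm]
    by_cases hj : monomial (sqfreeExp {j}) (1 : K) ∈ J
    · rw [X_smul_sqMon hj (by simpa using hij)]
    · by_cases hQ : sqfreeFamily I J {i, j}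
      · rw [sqCf_eq_zero hI hJ hQ (by simp) fun h => hj h.1, zero_smul, zero_smul]
      · rw [sqMon_eq_zero hQ, sqMon_eq_zero fun h => hj h.1, smul_zero]
  -- The second application, to the terms of the `v i` in degree x_i.
  obtain ⟨z, hz, -⟩ := exists_of_link_cocycle h2 l
    (w := fun i => sqCf I J {i} (v i) • sqMon I J {i}) fun i j hi hj => by
      by_cases hij : i = j
      · rw [hij]
      rw [hX i j hij, hX j i (Ne.symm hij), Finset.pair_comm j i]
      by_cases hQ : sqfreeFamily I J {i, j}
      · rw [hb i j hij hi hj hQ]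
      · rw [sqMon_eq_zero hQ, smul_zero, smul_zero]
  have hc : ∀ j, j ≠ l → sqfreeFamily I J {j, l} →
      (if j ∈ S then 1 else 0) = - sqCf I J ∅ (z l) - sqCf I J {l} (v l) := fun j hj hQ => by
    have h := congrArg (sqCf I J {j, l}) (hv j hj)
    rw [map_sub, sqCf_X_smul hI (by simpa using hj) hQ, Finset.pair_comm,
      sqCf_X_smul hI (by simpa using hj.symm) (by rwa [Finset.pair_comm]), Finset.pair_comm] at h
    have h3 : sqCf I J {j} (v j) = - sqCf I J ∅ (z l) := by
      by_cases hQj : sqfreeFamily I J {j}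
      · have h4 := congrArg (sqCf I J (insert j ∅)) (hz j hj)
        rw [map_sub, sqCf_X_smul hI (by simp) (by rwa [insert_empty_eq]), insert_empty_eq,
          sqCf_X_smul_of_notMem hI (by simpa using hj.symm) hQj, map_smul, sqCf_sqMon hI hQj,
          smul_eq_mul, mul_one, zero_sub] at h4
        exact h4
      -- If {j} is not in the family, then by convexity neither is the empty set, and both sides
      -- vanish.
      · rw [sqCf_eq_zero hI hJ hQ (by simp) hQj, sqCf_eq_zero hI hJ hQ (by simp) fun h =>
          hQj (h.of_subset hI hJ hQ (by simp) (by simp)), neg_zero]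
    rw [← h3, ← h]
    split_ifs
    · exact (sqCf_sqMon hI hQ).symm
    · exact (map_zero _).symm
  rcases S.eq_empty_or_nonempty with hS0 | ⟨k, hk⟩
  · exact Or.inl hS0
  · have hQk := (hS k hk).2
    have hk1 := hc k (hS k hk).1 hQk
    rw [if_pos hk] at hk1
    refine Or.inr ⟨?_, fun j hj hQ => ?_⟩
    · by_contra hQ
      rw [sqCf_eq_zero hI hJ hQk (by simp) hQ, sqCf_eq_zero hI hJ hQk (by simp) fun h =>
        hQ (h.of_subset hI hJ hQk (by simp) (by simp)), neg_zero, sub_zero] at hk1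
      exact one_ne_zero hk1
    · by_contra hjS
      rw [← hc j (by simpa using hj) hQ, if_neg hjS] at hk1
      exact one_ne_zero hk1

/-- With more pairs than triples, the simplicial coboundary from pairs to triples has a nonzero
kernel element c. Weighting the x_i x_j by c gives a Koszul 2-cocycle; the coefficients of its
bounding cochain that would produce c sit at single vertices, and there are none. -/
theorem pairsLeTriples_of_exact (hI : IsSquarefreeMonomialIdeal I)
    (hJ : IsSquarefreeMonomialIdeal J) : PairsLeTriples (sqfreeFamily I J) := by
  classical
  intro _ hQ1
  by_contra! hlt
  rw [← Fintype.card_coe, ← Fintype.card_coe, ← Module.finrank_fintype_fun_eq_card K,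
    ← Module.finrank_fintype_fun_eq_card K] at hlt
  let P := Finset.univ.filter fun x : Fin 4 × Fin 4 => x.1 < x.2 ∧ sqfreeFamily I J {x.1, x.2}
  let T := Finset.univ.filter fun x : Fin 4 × Fin 4 × Fin 4 =>
        x.1 < x.2.1 ∧ x.2.1 < x.2.2 ∧ sqfreeFamily I J {x.1, x.2.1, x.2.2}
  let E : (Fin 4 × Fin 4) → (P → K) →ₗ[K] K := fun x =>
    if h : x ∈ P then LinearMap.proj ⟨x, h⟩ else 0
  -- The alternating extension of a cochain on increasing pairs to all ordered pairs.
  let D : (Fin 4 × Fin 4) → (P → K) →ₗ[K] K := fun x => E x - E x.swap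
  let d : (P → K) →ₗ[K] (T → K) := LinearMap.pi fun x =>
    D (x.1.2.1, x.1.2.2) - D (x.1.1, x.1.2.2) + D (x.1.1, x.1.2.1)
  obtain ⟨c, hc, hc0⟩ := Submodule.exists_mem_ne_zero_of_ne_bot
    (LinearMap.ker_ne_bot_of_finrank_lt (f := d) hlt)
  rw [LinearMap.mem_ker] at hc
  have hD : ∀ i j, D (j, i) c = - D (i, j) c := fun i j => by simp [D]
  have hDJ : ∀ i j, D (i, j) c ≠ 0 → sqfreeFamily I J {i, j} := fun i j h => by
    by_contra hQ
    refine h ?_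
    have h1 : (i, j) ∉ P := by simp [P, hQ]
    have h2 : (j, i) ∉ P := by simp [P, Finset.pair_comm j i, hQ]
    simp [D, E, h1, h2]
  have hcyc : ∀ i j k, i < j → j < k → sqfreeFamily I J {i, j, k} →
      D (j, k) c - D (i, k) c + D (i, j) c = 0 := fun i j k hij hjk hQ =>
    congrFun hc ⟨(i, j, k), by simp [T, hij, hjk, hQ]⟩
  have hcyc' : ∀ i j k, i ≠ j → i ≠ k → j ≠ k → sqfreeFamily I J {i, j, k} →
      D (j, k) c - D (i, k) c + D (i, j) c = 0 := by
    intro i j k hij hik hjk hQ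
    have e1 : ({i, k, j} : Finset (Fin 4)) = {i, j, k} := by rw [Finset.pair_comm]
    have e2 : ({j, i, k} : Finset (Fin 4)) = {i, j, k} := Finset.insert_comm _ _ _
    have e3 : ({j, k, i} : Finset (Fin 4)) = {i, j, k} := by rw [← e2, Finset.pair_comm k i]
    have e4 : ({k, i, j} : Finset (Fin 4)) = {i, j, k} := by rw [Finset.insert_comm, e1]
    have e5 : ({k, j, i} : Finset (Fin 4)) = {i, j, k} := by rw [Finset.insert_comm, e3]
    -- Of the eight sign patterns, two are cyclic and impossible; the other six are the orderings of
    -- a triple, where the cocycle relation changes only by the sign of the permutation.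
    rcases hij.lt_or_gt with h1 | h1 <;> rcases hik.lt_or_gt with h2 | h2 <;>
      rcases hjk.lt_or_gt with h3 | h3
    · exact hcyc i j k h1 h3 hQ
    · have := hcyc i k j h2 h3 (e1 ▸ hQ)
      rw [hD j k] at this
      linear_combination -this
    · exact absurd (h1.trans h3) h2.not_gt
    · have := hcyc k i j h2 h1 (e4 ▸ hQ)
      rw [hD i k, hD j k] at this
      linear_combination this
    · have := hcyc j i k h1 h2 (e2 ▸ hQ)
      rw [hD i j] at this
      linear_combination -this
    · exact absurd (h1.trans h2) h3.not_gt
    · have := hcyc j k i h3 h2 (e3 ▸ hQ)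
      rw [hD i j, hD i k] at this
      linear_combination this
    · have := hcyc k j i h3 h1 (e5 ▸ hQ)
      rw [hD i j, hD i k, hD j k] at this
      linear_combination -this
  have hX : ∀ i j k, i ≠ j → i ≠ k →
      (X i : MvPolynomial (Fin 4) K) • D (j, k) c • sqMon I J {j, k} =
        D (j, k) c • sqMon I J {i, j, k} := fun i j k hij hik => by
    by_cases h0 : D (j, k) c = 0
    · rw [h0, zero_smul, zero_smul, smul_zero]
    · rw [smul_comm, X_smul_sqMon (hDJ j k h0).1 (by simp [hij, hik])]
  have hD0 : ∀ i, D (i, i) c = 0 := fun i => by simp [D]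
  obtain ⟨v, hv⟩ := h2 (fun i j => D (i, j) c • sqMon I J {i, j}) fun i j k => by
    by_cases hij : i = j
    · subst hij
      simp [hD0]
    by_cases hik : i = k
    · subst hik
      rw [hD i j, hD0, Finset.pair_comm j i]
      simp
    by_cases hjk : j = k
    · subst hjk
      simp [hD0]
    rw [hX i j k hij hik, hX j i k (Ne.symm hij) hjk, hX k i j (Ne.symm hik) (Ne.symm hjk),
      Finset.insert_comm j i, Finset.insert_comm k i, Finset.pair_comm k j, ← sub_smul, ← add_smul]
    by_cases hQ : sqfreeFamily I J {i, j, k}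
    · rw [hcyc' i j k hij hik hjk hQ, zero_smul]
    · rw [sqMon_eq_zero hQ, smul_zero]
  refine hc0 (funext fun ⟨⟨i, j⟩, hx⟩ => ?_)
  obtain ⟨hij, hQ⟩ : i < j ∧ sqfreeFamily I J {i, j} := by simpa [P] using hx
  have h := congrArg (sqCf I J {i, j}) (hv i j)
  rw [map_sub, sqCf_X_smul hI (by simpa using hij.ne) hQ, map_smul, sqCf_sqMon hI hQ,
    Finset.pair_comm, sqCf_X_smul hI (by simpa using hij.ne') (by rwa [Finset.pair_comm]),
    sqCf_eq_zero hI hJ hQ (by simp) (hQ1 j), sqCf_eq_zero hI hJ hQ (by simp) (hQ1 i)] at h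
  have hji : (j, i) ∉ P := by simp [P, hij.le]
  simpa [D, E, hx, hji] using h

end

end FactorModule

/-! ### Assembling the bound for each length of the regular sequence. -/

section FactorModule

variable {K : Type*} [Field K] {I J : Ideal (MvPolynomial (Fin 4) K)}

theorem IsSquarefreeMonomialIdeal.sqfreeExp_univ_mem (hI : IsSquarefreeMonomialIdeal I)
    (hI0 : I ≠ ⊥) : monomial (sqfreeExp Finset.univ) (1 : K) ∈ I := by
  obtain ⟨f, hf, hf0⟩ := Submodule.exists_mem_ne_zero_of_ne_bot hI0
  obtain ⟨a, ha⟩ := Finset.nonempty_iff_ne_empty.2 (mt support_eq_empty.1 hf0)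
  exact hI.monomial_mem (by simp) (hI.mem_iff.1 hf a ha)

open RingTheory.Sequence in
theorem length_le_stanleyDepth (hI : IsSquarefreeMonomialIdeal I)
    (hJ : IsSquarefreeMonomialIdeal J) (hI0 : I ≠ ⊥) {rs : List (MvPolynomial (Fin 4) K)}
    (hrs : ∀ f ∈ rs, f ∈ Ideal.span (Set.range (X : Fin 4 → MvPolynomial (Fin 4) K)))
    (hreg : IsRegular (FactorModule I J) rs) :
    (rs.length : ℕ∞) ≤ stanleyDepth (Fin 4) (FactorModule.component I J) := by
  obtain ⟨g, hg, hg0⟩ := Submodule.exists_mem_ne_zero_of_ne_bot hI0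
  have hlt : rs.length < 4 := length_lt_of_isRegular hg0 (fun u => by
    obtain ⟨f, rfl⟩ := Submodule.Quotient.mk_surjective _ u
    rw [← Submodule.Quotient.mk_smul, Submodule.Quotient.mk_eq_zero]
    exact I.mul_mem_right _ hg) hreg
  have huniv : ¬ sqfreeFamily I J Finset.univ := fun h => h.2 (hI.sqfreeExp_univ_mem hI0)
  have hconv : ∀ A B C, sqfreeFamily I J A → sqfreeFamily I J B → A ⊆ C → C ⊆ B →
      sqfreeFamily I J C := fun _ _ _ hA hB => hA.of_subset hI hJ hB
  have hw := hreg.toIsWeaklyRegular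
  suffices h : rs.length ≠ 0 → ∃ F, IsIntervalPartition (sqfreeFamily I J) rs.length F by
    by_cases h0 : rs.length = 0
    · simp [h0]
    · obtain ⟨F, hF⟩ := h h0
      exact hF.le_stanleyDepth hI hJ
  intro _
  match rs with
  | [] => contradiction
  | [f] =>
    simp only [List.mem_cons, List.not_mem_nil, or_false, forall_eq] at hrs
    exact exists_isIntervalPartition (by simp) huniv hconv
      (hasVertices_one (fun u => koszul_exact_zero hrs hw) hI) (by simp) (by simp)
  | [f, g] =>
    simp only [List.mem_cons, List.not_mem_nil, or_false, forall_eq_or_imp, forall_eq] at hrs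
    have h1 := fun u => koszul_exact_one (M := FactorModule I J) (u := u) hrs.1 hrs.2 hw
    exact exists_isIntervalPartition (by simp) huniv hconv (hasVertices_two h1 hI)
      (fun _ => isConnectedLink_empty h1 hI hJ) (by simp)
  | [f, g, k] =>
    simp only [List.mem_cons, List.not_mem_nil, or_false, forall_eq_or_imp, forall_eq] at hrs
    have h1 := fun u => koszul_exact_one (M := FactorModule I J) (u := u) hrs.1 hrs.2.1 hw
    have h2 := fun u => koszul_exact_two (M := FactorModule I J) (u := u) hrs.1 hrs.2.1 hrs.2.2 hw
    exact exists_isIntervalPartition (by simp) huniv hconv (hasVertices_three h2 hI)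
      (fun _ => isConnectedLink_empty h1 hI hJ)
      fun _ => ⟨pairsLeTriples_of_exact h2 hI hJ, isConnectedLink_singleton h2 hI hJ⟩
  | _ :: _ :: _ :: _ :: _ => simp only [List.length_cons] at hlt; omega

end FactorModule

theorem proposition4 {K : Type*} [Field K] (I J : Ideal (MvPolynomial (Fin 4) K))
    (hI : IsSquarefreeMonomialIdeal I) (hJ : IsSquarefreeMonomialIdeal J)
    (hIJ : I ≤ J) (hI0 : I ≠ ⊥) (hne : I ≠ J) :
    polyDepth K (Fin 4) (FactorModule I J) ≤
      stanleyDepth (Fin 4) (FactorModule.component I J) :=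
  iSup_le fun rs => length_le_stanleyDepth hI hJ hI0 rs.2.1 rs.2.2
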